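/- All Banach spaces are complex. For $x\in\ell_\infty(\mathbb{Z})$ and $a\in\ell_1(\mathbb{Z})$ write $\langle x,a\rangle=\sum_{n\in\mathbb{Z}}x(n)a(n)$. A closed subspace $E\subseteq\ell_\infty(\mathbb{Z})$ is called a predual of $\ell_1(\mathbb{Z})$ if the canonical map $\iota_E:\ell_1(\mathbb{Z})\to E^*$, $\iota_E(a)(x)=\langle x,a\rangle$, is an isomorphism of Banach spaces (not necessarily isometric); it is called shift-invariant if moreover $\sigma(E)=E$, where $\sigma(x)(n)=x(n-1)$ is the bilateral shift. An infinite set $J\subseteq\mathbb{Z}$ is called additively sparse if, for all $t\in\mathbb{Z}$ and all integers $r,s\ge 0$, there is $n\in\mathbb{N}$ such that whenever $j_1+\dots+j_r=l_1+\dots+l_s+t$ with $j_i,l_i\in J$, $n<|j_1|<\dots<|j_r|$ and $n<|l_1|<\dots<|l_s|$, then $t=0$, $r=s$ and $j_i=l_i$ for all $i$. Theorem 5.8. There exists a shift-invariant predual $E$ of $\ell_1(\mathbb{Z})$ such that, as a Banach space, $E$ is not isomorphic to $c_0$. More precisely, for every additively sparse set $J\subseteq\mathbb{Z}$ there is a shift-invariant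 predual $E$ of $\ell_1(\mathbb{Z})$ such that $\delta_n\to\frac12(\delta_0+\delta_1)$ in the weak*-topology induced by $E$ as $|n|\to\infty$ through $J$ (that is, $\langle x,\delta_n\rangle\to\langle x,\tfrac12(\delta_0+\delta_1)\rangle$ for every $x\in E$), and $E$ is not isomorphic to $c_0$ as a Banach space. -/

import Mathlib

open Filter Topology
open scoped ENNReal ZeroAtInfty

noncomputable section

/-- The complex Banach space `ℓ₁(ℤ)`. -/
abbrev EllOne : Type := lp (fun _ : ℤ => ℂ) 1

/-- The complex Banach space `ℓ_∞(ℤ)`. -/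
abbrev EllInfty : Type := lp (fun _ : ℤ => ℂ) ∞

/-- The duality bracket `⟨x, a⟩ = ∑ₙ x(n) a(n)` between `ℓ_∞(ℤ)` and `ℓ₁(ℤ)`. -/
def bracket (x : EllInfty) (a : EllOne) : ℂ := ∑' n : ℤ, x n * a n

/-- The series defining the bracket always converges. -/
theorem bracket_summable (x : EllInfty) (a : EllOne) : Summable fun n : ℤ => x n * a n := by
  have ha : Summable fun n : ℤ => ‖a n‖ := by
    have := (lp.memℓp a).summable (by simp)
    simpa using this
  refine Summable.of_norm_bounded (ha.mul_left ‖x‖) fun n => ?_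
  rw [norm_mul]
  exact mul_le_mul_of_nonneg_right (lp.norm_apply_le_norm ENNReal.top_ne_zero x n) (norm_nonneg _)

/-- The bilateral shift on `ℓ_∞(ℤ)`: `σ(x)(n) = x(n - 1)`. -/
def bilateralShift (x : EllInfty) : EllInfty :=
  ⟨fun n : ℤ => x (n - 1), memℓp_infty ⟨‖x‖, by
    rintro _ ⟨n, rfl⟩
    exact lp.norm_apply_le_norm ENNReal.top_ne_zero x (n - 1)⟩⟩

/-- A closed subspace `E` of `ℓ_∞(ℤ)` is a (concrete) predual of `ℓ₁(ℤ)` if the canonical map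
`ι_E : ℓ₁(ℤ) → E*`, `ι_E(a)(x) = ⟨x, a⟩`, is an isomorphism of Banach spaces
(not necessarily isometric). -/
def IsPredual (E : Submodule ℂ EllInfty) : Prop :=
  IsClosed (E : Set EllInfty) ∧
    ∃ ι : EllOne ≃L[ℂ] (E →L[ℂ] ℂ), ∀ (a : EllOne) (x : E), ι a x = bracket (x : EllInfty) a

/-- A predual `E ⊆ ℓ_∞(ℤ)` is shift-invariant if it is invariant under the bilateral shift
(and its inverse). -/
def IsShiftInvariantPredual (E : Submodule ℂ EllInfty) : Prop :=
  IsPredual E ∧ ∀ x : EllInfty, bilateralShift x ∈ E ↔ x ∈ E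

/-- The point mass `δₙ ∈ ℓ₁(ℤ)`. -/
def pointMass (n : ℤ) : EllOne := lp.single 1 n 1

/-- Convergence of `f` to `a` along a filter in the weak*-topology which a subspace
`E ⊆ ℓ_∞(ℤ)` induces on `ℓ₁(ℤ)`. -/
def WeakStarTendsto {α : Type*} (E : Submodule ℂ EllInfty) (f : α → EllOne) (l : Filter α)
    (a : EllOne) : Prop :=
  ∀ x ∈ E, Tendsto (fun i => bracket x (f i)) l (𝓝 (bracket x a))

/-- An infinite set `J ⊆ ℤ` is additively sparse if for all `t ∈ ℤ` and `r, s ≥ 0` there is `n`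
such that `j₁ + ⋯ + j_r = l₁ + ⋯ + l_s + t` with all `jᵢ, lᵢ ∈ J`, `n < |j₁| < ⋯ < |j_r|` and
`n < |l₁| < ⋯ < |l_s|` forces `t = 0`, `r = s` and `jᵢ = lᵢ` for every `i`. -/
def AdditivelySparse (J : Set ℤ) : Prop :=
  J.Infinite ∧ ∀ (t : ℤ) (r s : ℕ), ∃ n : ℕ, ∀ (j : Fin r → ℤ) (l : Fin s → ℤ),
    (∀ i, j i ∈ J) → (∀ i, l i ∈ J) →
    (∀ i, (n : ℤ) < |j i|) → (∀ i, (n : ℤ) < |l i|) →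
    StrictMono (fun i => |j i|) → StrictMono (fun i => |l i|) →
    ∑ i, j i = ∑ i, l i + t →
      t = 0 ∧ r = s ∧ ∀ (i : ℕ) (hr : i < r) (hs : i < s), j ⟨i, hr⟩ = l ⟨i, hs⟩

end

theorem tendsto_tsum_norm_sub_tsum_norm_sub {α ι : Type*} {l : Filter α} {G : α → ι → ℂ}
    {F : ι → ℂ} (hF : Summable fun i => ‖F i‖) (hG : ∀ a, Summable fun i => ‖G a i‖)
    (h : ∀ i, Tendsto (fun a => G a i) l (𝓝 (F i))) :
    Tendsto (fun a => ∑' i, ‖G a i‖ - ∑' i, ‖G a i - F i‖) l (𝓝 (∑' i, ‖F i‖)) := by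
  have hs : ∀ a, Summable fun i => ‖G a i - F i‖ := fun a =>
    ((hG a).add hF).of_nonneg_of_le (fun _ => norm_nonneg _) fun i => norm_sub_le _ _
  have key : Tendsto (fun a => ∑' i, (‖G a i‖ - ‖G a i - F i‖)) l (𝓝 (∑' i, ‖F i‖)) := by
    refine tendsto_tsum_of_dominated_convergence hF (fun i => ?_) (Eventually.of_forall fun a i => ?_)
    · have h1 := (h i).norm
      have h2 := ((h i).sub_const (F i)).norm
      simpa using h1.sub h2
    · have := abs_norm_sub_norm_le (G a i) (G a i - F i)
      simpa using this
  refine key.congr fun a => ?_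
  exact (hG a).tsum_sub (hs a)

theorem EllOne.summable_norm (a : EllOne) : Summable fun n : ℤ => ‖a n‖ := by
  have := (lp.memℓp a).summable (by simp)
  simpa using this

theorem EllOne.norm_eq (a : EllOne) : ‖a‖ = ∑' n : ℤ, ‖a n‖ := by
  have := lp.norm_eq_tsum_rpow (p := 1) (by simp) a
  simpa using this

theorem EllInfty.norm_apply_le (x : EllInfty) (n : ℤ) : ‖x n‖ ≤ ‖x‖ :=
  lp.norm_apply_le_norm ENNReal.top_ne_zero x n

theorem EllInfty.norm_le {x : EllInfty} {C : ℝ} (hC : 0 ≤ C) (h : ∀ n, ‖x n‖ ≤ C) : ‖x‖ ≤ C :=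
  lp.norm_le_of_forall_le hC h

theorem EllOne.norm_apply_le (a : EllOne) (n : ℤ) : ‖a n‖ ≤ ‖a‖ :=
  lp.norm_apply_le_norm one_ne_zero a n

theorem norm_bracket_le (x : EllInfty) (a : EllOne) : ‖bracket x a‖ ≤ ‖x‖ * ‖a‖ := by
  rw [EllOne.norm_eq, ← tsum_mul_left]
  refine tsum_of_norm_bounded (a.summable_norm.mul_left ‖x‖).hasSum fun n => ?_
  rw [norm_mul]
  exact mul_le_mul_of_nonneg_right (x.norm_apply_le n) (norm_nonneg _)

theorem bracket_add_right (x : EllInfty) (a b : EllOne) :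
    bracket x (a + b) = bracket x a + bracket x b := by
  unfold bracket
  rw [← (bracket_summable x a).tsum_add (bracket_summable x b)]
  exact tsum_congr fun n => by simp [mul_add]

theorem bracket_smul_right (x : EllInfty) (c : ℂ) (a : EllOne) :
    bracket x (c • a) = c * bracket x a := by
  unfold bracket
  rw [← tsum_mul_left]
  exact tsum_congr fun n => by simp [mul_left_comm]

theorem bracket_add_left (x y : EllInfty) (a : EllOne) :
    bracket (x + y) a = bracket x a + bracket y a := by
  unfold bracket
  rw [← (bracket_summable x a).tsum_add (bracket_summable y a)]
  exact tsum_congr fun n => by simp [add_mul]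

theorem bracket_smul_left (c : ℂ) (x : EllInfty) (a : EllOne) :
    bracket (c • x) a = c * bracket x a := by
  unfold bracket
  rw [← tsum_mul_left]
  exact tsum_congr fun n => by simp [mul_assoc]

/-- The bracket as a bounded bilinear map. -/
noncomputable def bracketCLM : EllInfty →L[ℂ] EllOne →L[ℂ] ℂ :=
  LinearMap.mkContinuous₂
    (LinearMap.mk₂ ℂ bracket bracket_add_left bracket_smul_left bracket_add_right
      fun c x a => bracket_smul_right x c a) 1 fun x a => by
    simpa using norm_bracket_le x a

@[simp]
theorem bracketCLM_apply (x : EllInfty) (a : EllOne) : bracketCLM x a = bracket x a := rfl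

theorem bracket_sub_left (x y : EllInfty) (a : EllOne) :
    bracket (x - y) a = bracket x a - bracket y a := by
  simp [← bracketCLM_apply]

theorem bracket_sub_right (x : EllInfty) (a b : EllOne) :
    bracket x (a - b) = bracket x a - bracket x b := by
  simp [← bracketCLM_apply]

theorem bracket_pointMass (x : EllInfty) (n : ℤ) : bracket x (pointMass n) = x n := by
  unfold bracket pointMass
  rw [tsum_eq_single n]
  · simp
  · intro m hm
    simp [lp.single_apply, hm]

theorem norm_pointMass (n : ℤ) : ‖pointMass n‖ = 1 := by
  unfold pointMass
  rw [lp.norm_single (by simp)]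
  simp

theorem EllOne.exists_pointwise_limit {α : Type*} (U : Ultrafilter α) (g : α → EllOne) {C : ℝ}
    (hg : ∀ i, ‖g i‖ ≤ C) : ∃ f : EllOne, ∀ n, Tendsto (fun i => g i n) U (𝓝 (f n)) := by
  have h : ∀ n, ∃ z : ℂ, Tendsto (fun i => g i n) U (𝓝 z) := fun n => by
    have hc : IsCompact (Metric.closedBall (0 : ℂ) C) := isCompact_closedBall _ _
    obtain ⟨z, -, hz⟩ := hc.ultrafilter_le_nhds (U.map fun i => g i n) (by
      rw [le_principal_iff]
      refine mem_map.2 (Eventually.of_forall fun i => ?_)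
      simpa using ((g i).norm_apply_le n).trans (hg i))
    exact ⟨z, hz⟩
  choose f hf using h
  have hmem : Memℓp f 1 := by
    refine lp.memℓp_of_tendsto (l := (U : Filter α)) (F := g) ?_ ?_
    · refine (isBounded_iff_forall_norm_le).2 ⟨C, ?_⟩
      rintro _ ⟨i, rfl⟩
      exact hg i
    · exact tendsto_pi_nhds.2 hf
  exact ⟨⟨f, hmem⟩, hf⟩

theorem exists_tendsto_real_of_bounded {α : Type*} (U : Ultrafilter α) (g : α → ℝ) {C : ℝ}
    (h0 : ∀ i, 0 ≤ g i) (hg : ∀ i, g i ≤ C) :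
    ∃ z, 0 ≤ z ∧ z ≤ C ∧ Tendsto g U (𝓝 z) := by
  obtain ⟨z, hz, hz'⟩ := (isCompact_Icc (a := (0 : ℝ)) (b := C)).ultrafilter_le_nhds (U.map g) (by
      rw [le_principal_iff]
      exact mem_map.2 (Eventually.of_forall fun i => ⟨h0 i, hg i⟩))
  exact ⟨z, hz.1, hz.2, hz'⟩

theorem tendsto_norm_sub_norm_sub {α : Type*} {l : Filter α} {g : α → EllOne} {f : EllOne}
    (h : ∀ n, Tendsto (fun i => g i n) l (𝓝 (f n))) :
    Tendsto (fun i => ‖g i‖ - ‖g i - f‖) l (𝓝 ‖f‖) := by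
  simp only [EllOne.norm_eq]
  exact tendsto_tsum_norm_sub_tsum_norm_sub f.summable_norm (fun i => (g i).summable_norm) h

/-- The bounded operator on `ℓ₁(ℤ)` sending `δₙ` to `v n`. -/
noncomputable def synthesis (v : ℤ → EllOne) (g : EllOne) : EllOne := ∑' n, g n • v n

theorem summable_synthesis {v : ℤ → EllOne} (hv : ∀ n, ‖v n‖ ≤ 1) (g : EllOne) :
    Summable fun n => g n • v n := by
  refine Summable.of_norm_bounded g.summable_norm fun n => ?_
  rw [norm_smul]
  exact mul_le_of_le_one_right (norm_nonneg _) (hv n)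

theorem norm_synthesis_le {v : ℤ → EllOne} (hv : ∀ n, ‖v n‖ ≤ 1) (g : EllOne) :
    ‖synthesis v g‖ ≤ ‖g‖ := by
  rw [g.norm_eq]
  refine tsum_of_norm_bounded g.summable_norm.hasSum fun n => ?_
  rw [norm_smul]
  exact mul_le_of_le_one_right (norm_nonneg _) (hv n)

theorem bracket_synthesis {v : ℤ → EllOne} (hv : ∀ n, ‖v n‖ ≤ 1) (x : EllInfty) (g : EllOne) :
    bracket x (synthesis v g) = ∑' n, bracket x (v n) * g n := by
  rw [← bracketCLM_apply, synthesis, (bracketCLM x).map_tsum (summable_synthesis hv g)]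
  exact tsum_congr fun n => by simp [mul_comm]

theorem tendsto_bracket_of_pointwise {α : Type*} {l : Filter α} {g : α → EllOne} {f : EllOne}
    (h : ∀ n, Tendsto (fun i => g i n) l (𝓝 (f n))) {x : EllInfty} {s : Finset ℤ}
    (hx : ∀ n ∉ s, x n = 0) : Tendsto (fun i => bracket x (g i)) l (𝓝 (bracket x f)) := by
  have hb : ∀ a : EllOne, bracket x a = ∑ n ∈ s, x n * a n := fun a =>
    tsum_eq_sum fun n hn => by simp [hx n hn]
  simp only [hb]
  exact tendsto_finsetSum _ fun n _ => (h n).const_mul _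

/-- Far out, the elements of `J` are arbitrarily far from all other elements of `J`. -/
def FarApart (J : Set ℤ) : Prop :=
  ∀ G : ℤ, ∃ τ : ℤ, ∀ j ∈ J, τ < |j| → ∀ l ∈ J, l ≠ j → G < |j - l|

theorem AdditivelySparse.farApart {J : Set ℤ} (hJ : AdditivelySparse J) : FarApart J := by
  intro G
  have h : ∀ t : ℤ, ∃ n : ℕ, t ≠ 0 → ∀ j ∈ J, ∀ l ∈ J, (n : ℤ) < |j| → (n : ℤ) < |l| →
      j ≠ l + t := by
    intro t
    obtain ⟨n, hn⟩ := hJ.2 t 1 1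
    refine ⟨n, fun ht j hj l hl hnj hnl h => ht ?_⟩
    exact (hn (fun _ => j) (fun _ => l) (fun _ => hj) (fun _ => hl) (fun _ => hnj) (fun _ => hnl)
      (fun a b hab => absurd hab (by simp [Subsingleton.elim a b]))
      (fun a b hab => absurd hab (by simp [Subsingleton.elim a b])) (by simpa using h)).1
  choose n hn using h
  refine ⟨(∑ t ∈ Finset.Icc (-G) G, (n t : ℤ)) + G, fun j hj hτ l hl hlj => ?_⟩
  by_contra! hG
  have hmem : j - l ∈ Finset.Icc (-G) G := by
    rw [Finset.mem_Icc]
    exact abs_le.1 hG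
  have hle : (n (j - l) : ℤ) ≤ ∑ t ∈ Finset.Icc (-G) G, (n t : ℤ) :=
    Finset.single_le_sum (f := fun t => (n t : ℤ)) (fun t _ => by positivity) hmem
  have h1 : |j| ≤ |l| + |j - l| := by
    have := abs_add_le l (j - l)
    simpa using this
  have h2 : 0 ≤ |j - l| := abs_nonneg _
  exact hn (j - l) (by omega) j hj l hl (by omega) (by omega) (by ring)

theorem FarApart.exists_radius {J : Set ℤ} (hJ : FarApart J) {c : ℤ} (hc : 0 ≤ c) :
    ∃ r > c, ∀ j ∈ J, c < |r - j| ∧ c < |r + j| := by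
  obtain ⟨τ, hτ⟩ := hJ (6 * c + 2)
  set B := |τ| + c + 1 with hB
  have hB' : τ ≤ |τ| := le_abs_self τ
  have hB0 : 0 ≤ |τ| := abs_nonneg τ
  by_contra! h
  have key : ∀ r, B ≤ r → ∃ j ∈ J, (|r - j| ≤ c ∨ |r + j| ≤ c) := by
    intro r hr
    obtain ⟨j, hj, hj'⟩ := h r (by omega)
    refine ⟨j, hj, ?_⟩
    by_contra! hcon
    exact absurd (hj' hcon.1) (by omega)
  obtain ⟨j₀, hj₀, h₀⟩ := key B le_rfl
  obtain ⟨j₁, hj₁, h₁⟩ := key (B + (2 * c + 1)) (by omega)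
  obtain ⟨j₂, hj₂, h₂⟩ := key (B + 2 * (2 * c + 1)) (by omega)
  have f01 := hτ j₀ hj₀
  have f12 := hτ j₁ hj₁
  have g01 := fun h h' => f01 h j₁ hj₁ h'
  have g02 := fun h h' => f01 h j₂ hj₂ h'
  have g12 := fun h h' => f12 h j₂ hj₂ h'
  simp only [abs_le, lt_abs, ne_eq] at *
  omega

/-- The window radii `q` and level thresholds `τ` used to define the parent relation. -/
structure IsScale (J : Set ℤ) (q τ : ℕ → ℤ) : Prop where
  q_nonneg : ∀ a, 0 ≤ q a
  tau_nonneg : ∀ a, 0 ≤ τ a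
  q_lt : ∀ a, q a < q (a + 1)
  gap : ∀ a, ∀ j ∈ J, q a + 5 < |q (a + 1) - j| ∧ q a + 5 < |q (a + 1) + j|
  tau_le : ∀ a, 100 * (q (a + 1) + τ a) + 100 ≤ τ (a + 1)
  isolated : ∀ a, ∀ j ∈ J, τ (a + 1) < |j| → ∀ l ∈ J, l ≠ j →
    100 * (q (a + 1) + τ a) + 100 < |j - l|

theorem FarApart.exists_isScale {J : Set ℤ} (hJ : FarApart J) : ∃ q τ, IsScale J q τ := by
  have step : ∀ p : {p : ℤ × ℤ // 0 ≤ p.1 ∧ 0 ≤ p.2}, ∃ p' : {p : ℤ × ℤ // 0 ≤ p.1 ∧ 0 ≤ p.2},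
      p.1.1 < p'.1.1 ∧ (∀ j ∈ J, p.1.1 + 5 < |p'.1.1 - j| ∧ p.1.1 + 5 < |p'.1.1 + j|) ∧
      100 * (p'.1.1 + p.1.2) + 100 ≤ p'.1.2 ∧
      ∀ j ∈ J, p'.1.2 < |j| → ∀ l ∈ J, l ≠ j → 100 * (p'.1.1 + p.1.2) + 100 < |j - l| := by
    rintro ⟨⟨q, τ⟩, hq, hτ⟩
    obtain ⟨r, hr, hr'⟩ := hJ.exists_radius (c := q + 5) (by simp at hq; omega)
    obtain ⟨σ, hσ⟩ := hJ (100 * (r + τ) + 100)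
    simp only at hq hτ
    refine ⟨⟨⟨r, max σ (100 * (r + τ) + 100)⟩, ?_, ?_⟩, ?_, hr', le_max_right _ _, ?_⟩
    · simp only; omega
    · simp only; omega
    · simp only; omega
    · exact fun j hj h => hσ j hj (lt_of_le_of_lt (le_max_left _ _) h)
  choose f hf using step
  let s : ℕ → {p : ℤ × ℤ // 0 ≤ p.1 ∧ 0 ≤ p.2} := fun n => f^[n] ⟨(0, 0), le_rfl, le_rfl⟩
  have hs : ∀ n, s (n + 1) = f (s n) := fun n => Function.iterate_succ_apply' f n _
  refine ⟨fun n => (s n).1.1, fun n => (s n).1.2, ⟨fun a => (s a).2.1, fun a => (s a).2.2,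
    fun a => ?_, fun a => ?_, fun a => ?_, fun a => ?_⟩⟩ <;> simp only [hs]
  exacts [(hf (s a)).1, (hf (s a)).2.1, (hf (s a)).2.2.1, (hf (s a)).2.2.2]

namespace IsScale

variable {J : Set ℤ} {q τ : ℕ → ℤ}

theorem q_strictMono (h : IsScale J q τ) : StrictMono q := strictMono_nat_of_lt_succ h.q_lt

theorem tau_strictMono (h : IsScale J q τ) : StrictMono τ :=
  strictMono_nat_of_lt_succ fun a => by
    have := h.tau_le a; have := h.q_nonneg (a + 1); have := h.tau_nonneg a; omega

theorem natCast_le_q (h : IsScale J q τ) (a : ℕ) : (a : ℤ) ≤ q a := by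
  induction a with
  | zero => simpa using h.q_nonneg 0
  | succ a ih => have := h.q_lt a; push_cast; omega

theorem natCast_le_tau (h : IsScale J q τ) (a : ℕ) : (a : ℤ) ≤ τ a := by
  induction a with
  | zero => simpa using h.tau_nonneg 0
  | succ a ih => have := h.tau_strictMono (Nat.lt_add_one a); push_cast; omega

theorem exists_level (h : IsScale J q τ) {a : ℕ} {j : ℤ} (hj : τ a < |j|) :
    ∃ b, a ≤ b ∧ τ b < |j| ∧ |j| ≤ τ (b + 1) := by
  classical
  have hex : ∃ c, |j| ≤ τ c := ⟨|j|.toNat, by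
    have := h.natCast_le_tau |j|.toNat; have := abs_nonneg j; omega⟩
  have hspec := Nat.find_spec hex
  have hlt : a < Nat.find hex := by
    by_contra! hle
    have := h.tau_strictMono.monotone hle
    omega
  obtain ⟨b, hb⟩ : ∃ b, Nat.find hex = b + 1 := ⟨Nat.find hex - 1, by omega⟩
  refine ⟨b, by omega, ?_, by rw [← hb]; exact hspec⟩
  exact not_le.1 (Nat.find_min hex (by omega))

end IsScale

/-- `n` lies in the window around `n - m ∈ J`. -/
def Parent (J : Set ℤ) (q τ : ℕ → ℤ) (n m : ℤ) : Prop :=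
  n - m ∈ J ∧ ∃ a, τ (a + 1) < |n - m| ∧ |n - m| ≤ τ (a + 2) ∧ -q (a + 1) ≤ m ∧ m < q (a + 1)

/-- The properties of a parent relation on which the construction of the predual rests. -/
structure IsBranching (J : Set ℤ) (P : ℤ → ℤ → Prop) : Prop where
  unique : ∀ {n m m'}, P n m → P n m' → m = m'
  natAbs_lt : ∀ {n m}, P n m → m.natAbs < n.natAbs ∧ (m + 1).natAbs < n.natAbs
  eventually : ∀ m, ∃ N : ℤ, ∀ j ∈ J, N < |j| → P (m + j) m
  edge : ∀ C : ℤ, ∃ N : ℤ, ∀ n, N < |n| →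
    (∀ m, P n m → P (n + 1) (m + 1) ∨ ∀ e, |e - m| ≤ 2 → C < |e| ∧ ∀ k, ¬ P e k) ∧
    (∀ m, P (n + 1) m → P n (m - 1) ∨ ∀ e, |e - m| ≤ 2 → C < |e| ∧ ∀ k, ¬ P e k)
  spread : ∀ w : ℤ, ∃ u s : ℕ, 0 < u ∧ 0 < s ∧ ∀ n : ℤ,
    (∃ e, (e = n ∨ e = n + u ∨ e = n + s ∨ e = n + u + s) ∧ w < |e| ∧ ∀ k, ¬ P e k) ∨
    ∃ m, ∀ e, (e = 0 ∨ e = (u : ℤ) ∨ e = s ∨ e = u + s) → w < |n + e| ∧ P (n + e) (m + e)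

namespace IsScale

variable {J : Set ℤ} {q τ : ℕ → ℤ}

theorem eq_of_close (h : IsScale J q τ) {j l : ℤ} {a b : ℕ} (hj : j ∈ J) (hl : l ∈ J)
    (hja : τ (a + 1) < |j|) (hlb : τ (b + 1) < |l|) {d : ℕ} (hd : d ≤ a ∨ d ≤ b)
    (hjl : |j - l| ≤ 10 * q (a + 1) + 10 * q (b + 1) + 50 * τ d + 50) : j = l := by
  by_contra hne
  rcases le_total a b with hab | hab
  · have := h.isolated b l hl hlb j hj hne
    rw [abs_sub_comm] at this
    have h1 := h.q_strictMono.monotone (show a + 1 ≤ b + 1 by omega)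
    have h2 := h.tau_strictMono.monotone (show d ≤ b by omega)
    have := h.q_nonneg (b + 1)
    have := h.tau_nonneg b
    omega
  · have := h.isolated a j hj hja l hl (Ne.symm hne)
    have h1 := h.q_strictMono.monotone (show b + 1 ≤ a + 1 by omega)
    have h2 := h.tau_strictMono.monotone (show d ≤ a by omega)
    have := h.q_nonneg (a + 1)
    have := h.tau_nonneg a
    omega

theorem orphan_near_radius (h : IsScale J q τ) (a : ℕ) {e : ℤ}
    (he : |e - q (a + 1)| ≤ 5 ∨ |e + q (a + 1)| ≤ 5) (k : ℤ) : ¬ Parent J q τ e k := by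
  rintro ⟨hJ, b, hb1, hb2, hk1, hk2⟩
  have hg := h.gap a _ hJ
  have ht := h.tau_le b
  have := h.tau_nonneg b
  have := h.q_nonneg (b + 1)
  have := h.q_nonneg (a + 1)
  rcases lt_or_ge b a with hba | hab
  · have := h.q_strictMono.monotone (show b + 1 ≤ a by omega)
    simp only [abs_le, lt_abs] at *
    omega
  · have h1 := h.q_strictMono.monotone (show a + 1 ≤ b + 1 by omega)
    simp only [abs_le, lt_abs] at *
    omega

theorem isBranching (h : IsScale J q τ) : IsBranching J (Parent J q τ) where
  unique := by
    rintro n m m' ⟨hJ, a, ha1, ha2, ha3, ha4⟩ ⟨hJ', b, hb1, hb2, hb3, hb4⟩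
    have := h.eq_of_close hJ hJ' ha1 hb1 (d := 0) (by omega) (by
      have := h.tau_nonneg 0
      rw [abs_le]
      constructor <;> omega)
    omega
  natAbs_lt := by
    rintro n m ⟨hJ, a, ha1, ha2, ha3, ha4⟩
    have ht := h.tau_le a
    have := h.tau_nonneg a
    have := h.q_nonneg (a + 1)
    simp only [lt_abs] at ha1
    omega
  eventually := by
    intro m
    refine ⟨τ (m.natAbs + 1), fun j hj hN => ?_⟩
    obtain ⟨b, hb, hb1, hb2⟩ := h.exists_level hN
    obtain ⟨a, rfl⟩ : ∃ a, b = a + 1 := ⟨b - 1, by omega⟩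
    have := h.natCast_le_q (a + 1)
    refine ⟨by simpa using hj, a, by simpa using hb1, by simpa using hb2, ?_, ?_⟩ <;> omega
  edge := by
    intro C
    set c := C.toNat with hc
    refine ⟨τ (c + 10) + q (c + 10), fun n hn => ?_⟩
    have large : ∀ {n m : ℤ} {a : ℕ}, τ (c + 10) + q (c + 10) ≤ |n| + 1 → |n - m| ≤ τ (a + 2) →
        -q (a + 1) ≤ m → m < q (a + 1) → c + 8 ≤ a := by
      intro n m a hn h2 h3 h4
      by_contra! hlt
      have e1 := h.tau_strictMono (show a + 2 < c + 10 by omega)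
      have e2 := h.q_strictMono (show a + 1 < c + 10 by omega)
      have e3 : |n| ≤ |n - m| + |m| := by simpa using abs_add_le (n - m) m
      have e4 : |m| ≤ q (a + 1) := abs_le.2 ⟨h3, h4.le⟩
      omega
    have hn1 : |n| ≤ |n + 1| + 1 := by
      have := abs_sub_abs_le_abs_sub n (n + 1)
      simp at this
      omega
    constructor
    · rintro m ⟨hJ, a, ha1, ha2, ha3, ha4⟩
      have ha := large (by omega) ha2 ha3 ha4
      by_cases hm : m + 1 < q (a + 1)
      · left
        refine ⟨by simpa using hJ, a, by simpa using ha1, by simpa using ha2, by omega, hm⟩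
      · right
        intro e he
        have hq := h.natCast_le_q (a + 1)
        rw [abs_le] at he
        refine ⟨?_, h.orphan_near_radius a (Or.inl (abs_le.2 ⟨by omega, by omega⟩))⟩
        rw [lt_abs]
        omega
    · rintro m ⟨hJ, a, ha1, ha2, ha3, ha4⟩
      have ha := large (by omega) ha2 ha3 ha4
      by_cases hm : -q (a + 1) ≤ m - 1
      · left
        have e : n - (m - 1) = n + 1 - m := by ring
        exact ⟨e ▸ hJ, a, e ▸ ha1, e ▸ ha2, hm, by omega⟩
      · right
        intro e he
        have hq := h.natCast_le_q (a + 1)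
        rw [abs_le] at he
        refine ⟨?_, h.orphan_near_radius a (Or.inr (abs_le.2 ⟨by omega, by omega⟩))⟩
        rw [lt_abs]
        omega
  spread := by
    intro w
    obtain ⟨c₀, hc₀⟩ : ∃ c₀, c₀ = w.toNat := ⟨_, rfl⟩
    have hbτ := h.natCast_le_tau (c₀ + 1)
    have hbq := h.natCast_le_q (c₀ + 1)
    have hτq := h.tau_le c₀
    push_cast at hbτ hbq
    have hτ0 := h.tau_nonneg c₀
    refine ⟨(2 * q (c₀ + 1)).toNat, (10 * τ (c₀ + 1)).toNat, by omega, by omega, fun n => ?_⟩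
    set u : ℤ := ((2 * q (c₀ + 1)).toNat : ℤ) with hu
    set s : ℤ := ((10 * τ (c₀ + 1)).toNat : ℤ) with hs
    have hu' : u = 2 * q (c₀ + 1) := by omega
    have hs' : s = 10 * τ (c₀ + 1) := by omega
    clear_value u s
    by_cases horph : ∃ e, (e = n ∨ e = n + u ∨ e = n + s ∨ e = n + u + s) ∧ w < |e| ∧
        ∀ k, ¬ Parent J q τ e k
    · exact Or.inl horph
    right
    push Not at horph
    -- outside `[-2 τ (c₀ + 1), 2 τ (c₀ + 1)]` every one of the four points lies in a window of level at least `c₀`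
    have win : ∀ e, (e = n ∨ e = n + u ∨ e = n + s ∨ e = n + u + s) → 2 * τ (c₀ + 1) < |e| →
        ∃ j ∈ J, ∃ a, c₀ ≤ a ∧ τ (a + 1) < |j| ∧ |j| ≤ τ (a + 2) ∧ -q (a + 1) ≤ e - j ∧
          e - j < q (a + 1) := by
      intro e he hbig
      obtain ⟨k, hJ, a, ha1, ha2, ha3, ha4⟩ := horph e he (by omega)
      refine ⟨e - k, hJ, a, ?_, ha1, ha2, by omega, by omega⟩
      by_contra! hlt
      have e1 := h.tau_strictMono.monotone (show a + 2 ≤ c₀ + 1 by omega)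
      have e2 := h.q_strictMono.monotone (show a + 1 ≤ c₀ + 1 by omega)
      have e3 : |e| ≤ |e - k| + |k| := by simpa using abs_add_le (e - k) k
      have e4 : |k| ≤ q (a + 1) := abs_le.2 ⟨ha3, ha4.le⟩
      omega
    have pair : ∀ e, (e = n ∨ e = n + s) → 2 * τ (c₀ + 1) < |e| → 2 * τ (c₀ + 1) < |e + u| →
        ∃ e', (e' = n ∨ e' = n + u ∨ e' = n + s ∨ e' = n + u + s) ∧ ∃ j ∈ J, ∃ a, c₀ + 1 ≤ a ∧
          τ (a + 1) < |j| ∧ |j| ≤ τ (a + 2) ∧ -q (a + 1) ≤ e' - j ∧ e' - j < q (a + 1) := by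
      intro e he h1 h2
      obtain ⟨j, hj, a, ha, ha1, ha2, ha3, ha4⟩ := win e (by omega) h1
      obtain ⟨l, hl, c, hc, hc1, hc2, hc3, hc4⟩ := win (e + u) (by omega) h2
      rcases Nat.lt_or_ge a (c₀ + 1) with hab | hab
      · rcases Nat.lt_or_ge c (c₀ + 1) with hcb | hcb
        · exfalso
          obtain rfl : a = c₀ := by omega
          obtain rfl : c = a := by omega
          have := h.eq_of_close (d := c) hj hl ha1 hc1
            (by omega) (by rw [abs_le]; constructor <;> omega)
          omega
        · exact ⟨e + u, by omega, l, hl, c, hcb, hc1, hc2, hc3, hc4⟩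
      · exact ⟨e, by omega, j, hj, a, hab, ha1, ha2, ha3, ha4⟩
    obtain ⟨e', he', j, hj, a, ha, ha1, ha2, ha3, ha4⟩ : ∃ e', (e' = n ∨ e' = n + u ∨ e' = n + s ∨
        e' = n + u + s) ∧ ∃ j ∈ J, ∃ a, c₀ + 1 ≤ a ∧
          τ (a + 1) < |j| ∧ |j| ≤ τ (a + 2) ∧ -q (a + 1) ≤ e' - j ∧ e' - j < q (a + 1) := by
      by_cases hn : 2 * τ (c₀ + 1) < |n| ∧ 2 * τ (c₀ + 1) < |n + u|
      · exact pair n (by omega) hn.1 hn.2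
      · refine pair (n + s) (by omega) ?_ ?_ <;>
        · rw [lt_abs]
          rw [lt_abs, lt_abs] at hn
          omega
    have hτa := h.tau_le a
    have hτba := h.tau_strictMono.monotone ha
    have hqa := h.q_nonneg (a + 1)
    have close : ∀ e, |e - e'| ≤ 11 * τ (c₀ + 1) → 2 * τ (c₀ + 1) < |e| := by
      intro e he
      rw [abs_le] at he
      rw [lt_abs] at ha1 ⊢
      omega
    refine ⟨n - j, fun e he => ?_⟩
    have hee : |n + e - e'| ≤ 11 * τ (c₀ + 1) := by
      rw [abs_le]
      omega
    have hbig := close _ hee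
    obtain ⟨l, hl, c, hc, hc1, hc2, hc3, hc4⟩ := win (n + e) (by omega) hbig
    rw [abs_le] at hee
    obtain rfl := h.eq_of_close hj hl ha1 hc1 (d := c₀ + 1) (by omega) (by
      rw [abs_le]
      constructor <;> omega)
    have e1 : n + e - (n - j + e) = j := by ring
    refine ⟨by omega, ?_⟩
    rw [Parent, e1]
    exact ⟨hj, c, hc1, hc2, by omega, by omega⟩

end IsScale

/-- The shift `(S x)(n) = x(n + 1)` on `ℓ_∞(ℤ)`, the inverse of the bilateral shift. -/
noncomputable def backShift : EllInfty →L[ℂ] EllInfty :=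
  LinearMap.mkContinuous
    { toFun := fun x => ⟨fun n : ℤ => x (n + 1), memℓp_infty ⟨‖x‖, by
        rintro _ ⟨n, rfl⟩
        exact x.norm_apply_le (n + 1)⟩⟩
      map_add' := fun _ _ => rfl
      map_smul' := fun _ _ => rfl } 1 fun x => by
    rw [one_mul]
    exact EllInfty.norm_le (norm_nonneg _) fun n => x.norm_apply_le (n + 1)

@[simp]
theorem backShift_apply (x : EllInfty) (n : ℤ) : backShift x n = x (n + 1) := rfl

@[simp]
theorem bilateralShift_apply (x : EllInfty) (n : ℤ) : bilateralShift x n = x (n - 1) := rfl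

theorem norm_backShift_le (x : EllInfty) : ‖backShift x‖ ≤ ‖x‖ :=
  EllInfty.norm_le (norm_nonneg _) fun n => x.norm_apply_le (n + 1)

theorem backShift_iterate_apply (x : EllInfty) (i : ℕ) (n : ℤ) :
    (backShift ^ i) x n = x (n + i) := by
  induction i generalizing n with
  | zero => simp
  | succ i ih =>
    rw [pow_succ', mul_apply_eq_comp, backShift_apply, ih,
      show n + 1 + (i : ℤ) = n + (i + 1 : ℕ) by push_cast; ring]

/-- The averaging operator `(A x)(n) = (x(n) + x(n + 1)) / 2` on `ℓ_∞(ℤ)`. -/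
noncomputable def averaging : EllInfty →L[ℂ] EllInfty := (1 / 2 : ℂ) • (1 + backShift)

theorem averaging_eq (x : EllInfty) : averaging x = (1 / 2 : ℂ) • (x + backShift x) := rfl

@[simp]
theorem averaging_apply (x : EllInfty) (n : ℤ) : averaging x n = (x n + x (n + 1)) / 2 := by
  rw [averaging_eq, lp.coeFn_smul, Pi.smul_apply, lp.coeFn_add, Pi.add_apply, backShift_apply,
    smul_eq_mul]
  ring

theorem norm_averaging_le (x : EllInfty) : ‖averaging x‖ ≤ ‖x‖ := by
  rw [averaging_eq, norm_smul]
  have h1 := norm_add_le x (backShift x)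
  have h2 := norm_backShift_le x
  norm_num
  linarith

theorem averaging_pow_succ (k : ℕ) (x : EllInfty) :
    (averaging ^ (k + 1)) x = averaging ((averaging ^ k) x) := by
  rw [pow_succ', mul_apply_eq_comp]

theorem averaging_pow_add (k l : ℕ) (x : EllInfty) :
    (averaging ^ (k + l)) x = (averaging ^ k) ((averaging ^ l) x) := by
  rw [pow_add, mul_apply_eq_comp]

theorem antitone_norm_averaging_pow (x : EllInfty) : Antitone fun k => ‖(averaging ^ k) x‖ :=
  antitone_nat_of_succ_le fun k => by
    rw [averaging_pow_succ]
    exact norm_averaging_le _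

theorem norm_averaging_pow_le (k : ℕ) (x : EllInfty) : ‖(averaging ^ k) x‖ ≤ ‖x‖ := by
  simpa using antitone_norm_averaging_pow x (Nat.zero_le k)

/-- The limit of the norms of `A ^ k x`. -/
noncomputable def asymptoticNorm (x : EllInfty) : ℝ := ⨅ k, ‖(averaging ^ k) x‖

theorem tendsto_asymptoticNorm (x : EllInfty) :
    Tendsto (fun k => ‖(averaging ^ k) x‖) atTop (𝓝 (asymptoticNorm x)) :=
  tendsto_atTop_ciInf (antitone_norm_averaging_pow x)
    ⟨0, by rintro _ ⟨k, rfl⟩; exact norm_nonneg _⟩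

theorem asymptoticNorm_le (x : EllInfty) : asymptoticNorm x ≤ ‖x‖ :=
  le_of_tendsto' (tendsto_asymptoticNorm x) fun k => norm_averaging_pow_le k x

theorem asymptoticNorm_averaging_pow (k : ℕ) (x : EllInfty) :
    asymptoticNorm ((averaging ^ k) x) = asymptoticNorm x := by
  refine tendsto_nhds_unique (tendsto_asymptoticNorm _) ?_
  simpa only [averaging_pow_add] using
    (tendsto_add_atTop_iff_nat k).2 (tendsto_asymptoticNorm x)

theorem norm_averaging_pow_sub_le (i : ℕ) (x : EllInfty) :
    ‖(averaging ^ (i + 1)) x - (1 / 2 ^ (i + 1) : ℂ) • (x + (backShift ^ (i + 1)) x)‖ ≤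
      (1 - 1 / 2 ^ i) * ‖x‖ := by
  have hS : ∀ i, ‖(backShift ^ i) x‖ ≤ ‖x‖ := fun i =>
    EllInfty.norm_le (norm_nonneg _) fun n => by
      rw [backShift_iterate_apply]; exact x.norm_apply_le _
  induction i with
  | zero => simp [averaging_eq]
  | succ i ih =>
    have e : (averaging ^ (i + 1 + 1)) x -
        (1 / 2 ^ (i + 1 + 1) : ℂ) • (x + (backShift ^ (i + 1 + 1)) x) =
        averaging ((averaging ^ (i + 1)) x -
          (1 / 2 ^ (i + 1) : ℂ) • (x + (backShift ^ (i + 1)) x)) +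
        (1 / 2 ^ (i + 2) : ℂ) • ((backShift ^ 1) x + (backShift ^ (i + 1)) x) := by
      rw [averaging_pow_succ (i + 1), map_sub, map_smul, averaging_eq (x + _), map_add,
        pow_succ' backShift (i + 1), mul_apply_eq_comp, pow_one]
      match_scalars <;> ring
    rw [e]
    refine (norm_add_le _ _).trans ?_
    have h1 := (norm_averaging_le _).trans ih
    have h2 : ‖(1 / 2 ^ (i + 2) : ℂ) • ((backShift ^ 1) x + (backShift ^ (i + 1)) x)‖ ≤
        1 / 2 ^ (i + 2) * (‖x‖ + ‖x‖) := by
      rw [norm_smul]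
      have := norm_add_le ((backShift ^ 1) x) ((backShift ^ (i + 1)) x)
      have h3 : ‖(1 / 2 ^ (i + 2) : ℂ)‖ = 1 / 2 ^ (i + 2) := by simp
      rw [h3]
      gcongr
      exact this.trans (add_le_add (hS _) (hS _))
    refine (add_le_add h1 h2).trans (le_of_eq ?_)
    field_simp
    ring

theorem two_mul_asymptoticNorm_le (x : EllInfty) {i : ℕ} (hi : 0 < i) :
    2 * asymptoticNorm x ≤ asymptoticNorm (x + (backShift ^ i) x) := by
  obtain ⟨i, rfl⟩ : ∃ l, i = l + 1 := ⟨i - 1, by omega⟩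
  have hcomm : ∀ k y, (averaging ^ k) ((backShift ^ (i + 1)) y) =
      (backShift ^ (i + 1)) ((averaging ^ k) y) := fun k y => by
    have h1 : Commute averaging backShift := ContinuousLinearMap.ext fun z => by
      rw [mul_apply_eq_comp, mul_apply_eq_comp, averaging_eq,
        averaging_eq, map_smul, map_add]
    have h2 := h1.pow_pow k (i + 1)
    exact congrArg (fun f => f y) h2
  have key : ∀ k, ‖(averaging ^ (k + (i + 1))) x‖ ≤
      1 / 2 ^ (i + 1) * ‖(averaging ^ k) (x + (backShift ^ (i + 1)) x)‖ +
        (1 - 1 / 2 ^ i) * ‖(averaging ^ k) x‖ := by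
    intro k
    have h := norm_averaging_pow_sub_le i ((averaging ^ k) x)
    rw [← averaging_pow_add, ← hcomm, ← map_add, add_comm] at h
    have h2 := norm_le_norm_add_norm_sub'
      ((averaging ^ (k + (i + 1))) x)
      ((1 / 2 ^ (i + 1) : ℂ) • (averaging ^ k) (x + (backShift ^ (i + 1)) x))
    rw [norm_smul] at h2
    have h3 : ‖(1 / 2 ^ (i + 1) : ℂ)‖ = 1 / 2 ^ (i + 1) := by simp
    rw [h3] at h2
    linarith
  have l1 := (tendsto_add_atTop_iff_nat (i + 1)).2 (tendsto_asymptoticNorm x)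
  have l2 := ((tendsto_asymptoticNorm (x + (backShift ^ (i + 1)) x)).const_mul
    (1 / 2 ^ (i + 1) : ℝ)).add ((tendsto_asymptoticNorm x).const_mul (1 - 1 / 2 ^ i : ℝ))
  have := le_of_tendsto_of_tendsto' l1 l2 key
  have hp : (0 : ℝ) < 2 ^ i := by positivity
  have h4 : (1 / 2 ^ i : ℝ) * asymptoticNorm x ≤
      1 / 2 ^ (i + 1) * asymptoticNorm (x + (backShift ^ (i + 1)) x) := by linarith
  rw [pow_succ] at h4
  field_simp at h4
  linarith

section Pull

variable {J : Set ℤ} {P : ℤ → ℤ → Prop}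

open Classical in
/-- The operator `T`: at `n` with parent `m` it takes the average of `x(m)` and `x(m + 1)`, and it
vanishes at orphans. -/
noncomputable def pull (P : ℤ → ℤ → Prop) (x : ℤ → ℂ) (n : ℤ) : ℂ :=
  if h : ∃ m, P n m then (x h.choose + x (h.choose + 1)) / 2 else 0

theorem IsBranching.pull_eq (hP : IsBranching J P) (x : ℤ → ℂ) {n m : ℤ} (h : P n m) :
    pull P x n = (x m + x (m + 1)) / 2 := by
  have hex : ∃ m, P n m := ⟨m, h⟩
  rw [pull, dif_pos hex, hP.unique hex.choose_spec h]

theorem pull_eq_zero (x : ℤ → ℂ) {n : ℤ} (h : ∀ m, ¬ P n m) : pull P x n = 0 :=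
  dif_neg (by simpa using h)

theorem pull_add (x y : ℤ → ℂ) (n : ℤ) : pull P (x + y) n = pull P x n + pull P y n := by
  unfold pull
  split_ifs
  · simp only [Pi.add_apply]; ring
  · simp

theorem pull_smul (c : ℂ) (x : ℤ → ℂ) (n : ℤ) : pull P (c • x) n = c * pull P x n := by
  unfold pull
  split_ifs
  · simp only [Pi.smul_apply, smul_eq_mul]; ring
  · simp

/-- The bounded functions which are fixed by `T` off `[-w, w]`. -/
noncomputable def level (P : ℤ → ℤ → Prop) (w : ℤ) : Submodule ℂ EllInfty where
  carrier := {x | ∀ n, w < |n| → x n = pull P x n}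
  zero_mem' := fun n _ => by
    unfold pull
    split_ifs <;> simp
  add_mem' := by
    intro x y hx hy n hn
    rw [lp.coeFn_add, pull_add, Pi.add_apply, hx n hn, hy n hn]
  smul_mem' := by
    intro c x hx n hn
    rw [lp.coeFn_smul, pull_smul, Pi.smul_apply, hx n hn, smul_eq_mul]

theorem level_mono {v w : ℤ} (h : v ≤ w) : level P v ≤ level P w :=
  fun _ hx n hn => hx n (lt_of_le_of_lt h hn)

/-- The bounded functions which are fixed by `T` off a finite set. -/
noncomputable def core (P : ℤ → ℤ → Prop) : Submodule ℂ EllInfty where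
  carrier := {x | ∃ w, x ∈ level P w}
  zero_mem' := ⟨0, zero_mem _⟩
  add_mem' := by
    rintro x y ⟨v, hv⟩ ⟨w, hw⟩
    exact ⟨max v w, add_mem (level_mono (le_max_left _ _) hv) (level_mono (le_max_right _ _) hw)⟩
  smul_mem' := by
    rintro c x ⟨w, hw⟩
    exact ⟨w, (level P w).smul_mem c hw⟩

theorem level_le_core (w : ℤ) : level P w ≤ core P := fun _ hx => ⟨w, hx⟩

theorem IsBranching.exists_pull_shift (hP : IsBranching J P) {x : EllInfty} {w : ℤ}
    (hx : ∀ n, w < |n| → x n = pull P x n) :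
    ∃ N : ℤ, w ≤ N ∧ ∀ n, N < |n| →
      pull P x (n + 1) = pull P (backShift x) n ∧
      pull P (bilateralShift x) (n + 1) = pull P x n := by
  obtain ⟨N, hN⟩ := hP.edge w
  refine ⟨max w N, le_max_left _ _, fun n hn => ?_⟩
  obtain ⟨h1, h2⟩ := hN n (lt_of_le_of_lt (le_max_right _ _) hn)
  have zero : ∀ {m e : ℤ}, (∀ e, |e - m| ≤ 2 → w < |e| ∧ ∀ k, ¬ P e k) → |e - m| ≤ 2 →
      x e = 0 := fun he hm => by
    rw [hx _ (he _ hm).1, pull_eq_zero _ (he _ hm).2]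
  by_cases hc : ∃ m, P n m ∧ P (n + 1) (m + 1)
  · obtain ⟨m, hm, hm'⟩ := hc
    rw [hP.pull_eq _ hm', hP.pull_eq _ hm, hP.pull_eq _ hm', hP.pull_eq _ hm]
    simp only [backShift_apply, bilateralShift_apply, add_sub_cancel_right, and_self]
  · have a1 : pull P (backShift x) n = 0 ∧ pull P x n = 0 := by
      by_cases hp : ∃ m, P n m
      · obtain ⟨m, hm⟩ := hp
        have he := (h1 m hm).resolve_left fun h => hc ⟨m, hm, h⟩
        rw [hP.pull_eq _ hm, hP.pull_eq _ hm, backShift_apply, backShift_apply,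
          zero he (by norm_num : |m - m| ≤ 2), zero he (by norm_num : |m + 1 - m| ≤ 2),
          zero he (by ring_nf; norm_num : |m + 1 + 1 - m| ≤ 2)]
        simp
      · push Not at hp
        exact ⟨pull_eq_zero _ hp, pull_eq_zero _ hp⟩
    have a2 : pull P x (n + 1) = 0 ∧ pull P (bilateralShift x) (n + 1) = 0 := by
      by_cases hp : ∃ m, P (n + 1) m
      · obtain ⟨m, hm⟩ := hp
        have he := (h2 m hm).resolve_left fun h => hc ⟨m - 1, h, by simpa using hm⟩
        rw [hP.pull_eq _ hm, hP.pull_eq _ hm, bilateralShift_apply, bilateralShift_apply,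
          zero he (by norm_num : |m - m| ≤ 2), zero he (by norm_num : |m + 1 - m| ≤ 2),
          zero he (by norm_num : |m - 1 - m| ≤ 2),
          zero he (by norm_num : |m + 1 - 1 - m| ≤ 2)]
        simp
      · push Not at hp
        exact ⟨pull_eq_zero _ hp, pull_eq_zero _ hp⟩
    rw [a1.1, a1.2, a2.1, a2.2]
    exact ⟨rfl, rfl⟩

theorem IsBranching.backShift_mem_core (hP : IsBranching J P) {x : EllInfty} (hx : x ∈ core P) :
    backShift x ∈ core P := by
  obtain ⟨w, hw⟩ := hx
  obtain ⟨N, hwN, hN⟩ := hP.exists_pull_shift hw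
  refine ⟨N + 1, fun n hn => ?_⟩
  rw [backShift_apply, hw, (hN n (by omega)).1]
  have := abs_sub_abs_le_abs_sub n (n + 1)
  simp at this
  omega

theorem IsBranching.bilateralShift_mem_core (hP : IsBranching J P) {x : EllInfty}
    (hx : x ∈ core P) : bilateralShift x ∈ core P := by
  obtain ⟨w, hw⟩ := hx
  obtain ⟨N, hwN, hN⟩ := hP.exists_pull_shift hw
  refine ⟨N + 1, fun n hn => ?_⟩
  have := abs_sub_abs_le_abs_sub n (n - 1)
  simp at this
  have h := (hN (n - 1) (by omega)).2
  rw [sub_add_cancel] at h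
  rw [bilateralShift_apply, hw _ (by omega), h]

theorem IsBranching.averaging_mem_core (hP : IsBranching J P) {x : EllInfty} (hx : x ∈ core P) :
    averaging x ∈ core P :=
  (core P).smul_mem _ ((core P).add_mem hx (hP.backShift_mem_core hx))

theorem IsBranching.averaging_pow_mem_core (hP : IsBranching J P) {x : EllInfty}
    (hx : x ∈ core P) (k : ℕ) : (averaging ^ k) x ∈ core P := by
  induction k with
  | zero => simpa using hx
  | succ k ih =>
    rw [averaging_pow_succ]
    exact hP.averaging_mem_core ih

theorem IsBranching.exists_four_point_bound (hP : IsBranching J P) {x : EllInfty}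
    (hx : x ∈ core P) : ∃ u s : ℕ, 0 < u ∧ 0 < s ∧ ∀ n : ℤ,
      ‖x n‖ + ‖x (n + u)‖ + ‖x (n + s)‖ + ‖x (n + u + s)‖ ≤ 3 * ‖x‖ := by
  obtain ⟨w, hw⟩ := hx
  obtain ⟨u, s, hu, hs, h⟩ := hP.spread w
  refine ⟨u, s, hu, hs, fun n => ?_⟩
  induction hk : n.natAbs using Nat.strong_induction_on generalizing n with
  | _ k ih =>
    rcases h n with ⟨e, he, hwe, ho⟩ | ⟨m, hm⟩
    · have h0 : x e = 0 := by rw [hw e hwe, pull_eq_zero _ ho]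
      have b1 := x.norm_apply_le n
      have b2 := x.norm_apply_le (n + u)
      have b3 := x.norm_apply_le (n + s)
      have b4 := x.norm_apply_le (n + u + s)
      rcases he with rfl | rfl | rfl | rfl <;> rw [h0, norm_zero] <;> linarith
    · have hval : ∀ e, (e = 0 ∨ e = (u : ℤ) ∨ e = s ∨ e = u + s) →
          ‖x (n + e)‖ ≤ (‖x (m + e)‖ + ‖x (m + 1 + e)‖) / 2 := by
        intro e he
        obtain ⟨h1, h2⟩ := hm e he
        rw [hw _ h1, hP.pull_eq _ h2, norm_div, show m + 1 + e = m + e + 1 by ring]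
        have := norm_add_le (x (m + e)) (x (m + e + 1))
        norm_num
        linarith
      have hlt := hP.natAbs_lt (hm 0 (Or.inl rfl)).2
      simp only [add_zero] at hlt
      have i1 := ih _ (hk ▸ hlt.1) m rfl
      have i2 := ih _ (hk ▸ hlt.2) (m + 1) rfl
      have v0 := hval 0 (by simp)
      have v1 := hval u (by simp)
      have v2 := hval s (by simp)
      have v3 := hval (u + s) (by simp)
      simp only [add_zero, ← add_assoc] at v0 v3
      linarith

theorem IsBranching.tendsto_norm_averaging_pow (hP : IsBranching J P) {x : EllInfty}
    (hx : x ∈ core P) : Tendsto (fun k => ‖(averaging ^ k) x‖) atTop (𝓝 0) := by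
  have key : ∀ y ∈ core P, asymptoticNorm y ≤ 3 / 4 * ‖y‖ := by
    intro y hy
    obtain ⟨u, s, hu, hs, h⟩ := hP.exists_four_point_bound hy
    have h1 := two_mul_asymptoticNorm_le y hu
    have h2 := two_mul_asymptoticNorm_le (y + (backShift ^ u) y) hs
    have h3 := asymptoticNorm_le (y + (backShift ^ u) y + (backShift ^ s) (y + (backShift ^ u) y))
    have h4 : ‖y + (backShift ^ u) y + (backShift ^ s) (y + (backShift ^ u) y)‖ ≤ 3 * ‖y‖ := by
      refine EllInfty.norm_le (by positivity) fun n => ?_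
      refine le_trans ?_ (h n)
      simp only [map_add, lp.coeFn_add, Pi.add_apply, backShift_iterate_apply]
      rw [show n + (u : ℤ) + s = n + s + u by ring, ← add_assoc]
      exact (norm_add_le _ _).trans (add_le_add_left ((norm_add_le _ _).trans
        (add_le_add_left (norm_add_le _ _) _)) _)
    linarith
  have h0 : asymptoticNorm x ≤ 3 / 4 * asymptoticNorm x := by
    refine ge_of_tendsto' ((tendsto_asymptoticNorm x).const_mul (3 / 4)) fun k => ?_
    rw [← asymptoticNorm_averaging_pow k x]
    exact key _ (hP.averaging_pow_mem_core hx k)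
  have h1 : 0 ≤ asymptoticNorm x := ge_of_tendsto' (tendsto_asymptoticNorm x) fun _ => norm_nonneg _
  have h2 : asymptoticNorm x = 0 := by linarith
  simpa only [h2] using tendsto_asymptoticNorm x

end Pull

/-- The preadjoint of the averaging operator. -/
noncomputable def preAveraging : EllOne → EllOne :=
  synthesis fun n => (1 / 2 : ℂ) • (pointMass n + pointMass (n + 1))

theorem norm_half_smul_pointMass_add_le (n m : ℤ) :
    ‖(1 / 2 : ℂ) • (pointMass n + pointMass m)‖ ≤ 1 := by
  rw [norm_smul]
  have := norm_add_le (pointMass n) (pointMass m)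
  rw [norm_pointMass, norm_pointMass] at this
  norm_num
  linarith

theorem bracket_half_smul_pointMass_add (x : EllInfty) (n : ℤ) :
    bracket x ((1 / 2 : ℂ) • (pointMass n + pointMass (n + 1))) = averaging x n := by
  rw [bracket_smul_right, bracket_add_right, bracket_pointMass, bracket_pointMass,
    averaging_apply]
  ring

theorem norm_preAveraging_le (a : EllOne) : ‖preAveraging a‖ ≤ ‖a‖ :=
  norm_synthesis_le (fun n => norm_half_smul_pointMass_add_le n (n + 1)) a

theorem bracket_preAveraging (x : EllInfty) (a : EllOne) :
    bracket x (preAveraging a) = bracket (averaging x) a := by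
  rw [preAveraging, bracket_synthesis fun n => norm_half_smul_pointMass_add_le n (n + 1)]
  simp only [bracket_half_smul_pointMass_add]
  rfl

theorem norm_preAveraging_iterate_le (k : ℕ) (a : EllOne) : ‖preAveraging^[k] a‖ ≤ ‖a‖ := by
  induction k with
  | zero => simp
  | succ k ih =>
    rw [Function.iterate_succ_apply']
    exact (norm_preAveraging_le _).trans ih

theorem bracket_preAveraging_iterate (k : ℕ) (x : EllInfty) (a : EllOne) :
    bracket x (preAveraging^[k] a) = bracket ((averaging ^ k) x) a := by
  induction k generalizing x with
  | zero => simp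
  | succ k ih =>
    rw [Function.iterate_succ_apply', bracket_preAveraging, ih, averaging_pow_add, pow_one]

section Predual

variable {J : Set ℤ} {P : ℤ → ℤ → Prop}

/-! ### Extending functions from a window -/

open Classical in
/-- The extension of a function on `[-w, w]` by the recursion `x = T x`. -/
noncomputable def extend (P : ℤ → ℤ → Prop) (w : ℤ) (u : ℤ → ℂ) (n : ℤ) : ℂ :=
  if |n| ≤ w then u n
  else if h : ∃ m, P n m ∧ m.natAbs < n.natAbs ∧ (m + 1).natAbs < n.natAbs then
    (extend P w u h.choose + extend P w u (h.choose + 1)) / 2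
  else 0
termination_by n.natAbs
decreasing_by exacts [h.choose_spec.2.1, h.choose_spec.2.2]

theorem extend_eq (w : ℤ) (u : ℤ → ℂ) {n : ℤ} (h : |n| ≤ w) : extend P w u n = u n := by
  rw [extend, if_pos h]

theorem IsBranching.extend_eq_pull (hP : IsBranching J P) (w : ℤ) (u : ℤ → ℂ) {n : ℤ}
    (h : w < |n|) : extend P w u n = pull P (extend P w u) n := by
  rw [extend, if_neg (not_le.2 h)]
  by_cases hp : ∃ m, P n m
  · obtain ⟨m, hm⟩ := hp
    have hex : ∃ m, P n m ∧ m.natAbs < n.natAbs ∧ (m + 1).natAbs < n.natAbs :=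
      ⟨m, hm, hP.natAbs_lt hm⟩
    rw [dif_pos hex, hP.pull_eq _ hex.choose_spec.1]
  · push Not at hp
    rw [pull_eq_zero _ hp, dif_neg]
    rintro ⟨m, hm, -⟩
    exact hp m hm

theorem IsBranching.norm_le_of_eq_pull (hP : IsBranching J P) {w : ℤ} {x : ℤ → ℂ}
    (hx : ∀ n, w < |n| → x n = pull P x n) {C : ℝ} (hC : 0 ≤ C) (h : ∀ n, |n| ≤ w → ‖x n‖ ≤ C)
    (n : ℤ) : ‖x n‖ ≤ C := by
  induction hk : n.natAbs using Nat.strong_induction_on generalizing n with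
  | _ k ih =>
    rcases le_or_gt |n| w with hn | hn
    · exact h n hn
    · rw [hx n hn]
      by_cases hp : ∃ m, P n m
      · obtain ⟨m, hm⟩ := hp
        have hlt := hP.natAbs_lt hm
        have i1 := ih _ (hk ▸ hlt.1) m rfl
        have i2 := ih _ (hk ▸ hlt.2) (m + 1) rfl
        rw [hP.pull_eq _ hm, norm_div]
        have := norm_add_le (x m) (x (m + 1))
        norm_num
        linarith
      · push Not at hp
        rw [pull_eq_zero _ hp, norm_zero]
        exact hC

theorem IsBranching.norm_le_of_mem_level (hP : IsBranching J P) {w : ℤ} {x : EllInfty}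
    (hx : x ∈ level P w) {C : ℝ} (hC : 0 ≤ C) (h : ∀ n, |n| ≤ w → ‖x n‖ ≤ C) : ‖x‖ ≤ C :=
  EllInfty.norm_le hC (hP.norm_le_of_eq_pull hx hC h)

theorem IsBranching.eq_of_mem_level (hP : IsBranching J P) {w : ℤ} {x y : EllInfty}
    (hx : x ∈ level P w) (hy : y ∈ level P w) (h : ∀ n, |n| ≤ w → x n = y n) : x = y := by
  have := hP.norm_le_of_mem_level (sub_mem hx hy) le_rfl fun n hn => by simp [h n hn]
  exact sub_eq_zero.1 (norm_le_zero_iff.1 this)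

theorem IsBranching.norm_extend_single_le (hP : IsBranching J P) (w k n : ℤ) :
    ‖extend P w (Pi.single k 1) n‖ ≤ 1 := by
  refine hP.norm_le_of_eq_pull (fun n hn => hP.extend_eq_pull w _ hn) zero_le_one
    (fun n hn => ?_) n
  rw [extend_eq w _ hn, Pi.single_apply]
  split_ifs <;> simp

/-- The element of `level P w` which agrees with `δ_k` on `[-w, w]`. -/
noncomputable def IsBranching.levelBasis (hP : IsBranching J P) (w k : ℤ) : EllInfty :=
  ⟨extend P w (Pi.single k 1), memℓp_infty ⟨1, by
    rintro _ ⟨n, rfl⟩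
    exact hP.norm_extend_single_le w k n⟩⟩

theorem IsBranching.levelBasis_mem_level (hP : IsBranching J P) (w k : ℤ) :
    hP.levelBasis w k ∈ level P w :=
  fun _ hn => hP.extend_eq_pull w _ hn

theorem IsBranching.levelBasis_apply (hP : IsBranching J P) (w k : ℤ) {n : ℤ} (hn : |n| ≤ w) :
    hP.levelBasis w k n = if n = k then 1 else 0 := by
  change extend P w (Pi.single k 1) n = _
  rw [extend_eq w _ hn, Pi.single_apply]

theorem IsBranching.sum_smul_levelBasis_apply (hP : IsBranching J P) (w : ℤ) (c : ℤ → ℂ) {n : ℤ}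
    (hn : |n| ≤ w) :
    (∑ k ∈ Finset.Icc (-w) w, c k • hP.levelBasis w k : EllInfty) n = c n := by
  rw [lp.coeFn_sum, Finset.sum_apply, Finset.sum_eq_single n]
  · rw [lp.coeFn_smul, Pi.smul_apply, hP.levelBasis_apply w n hn]
    simp
  · intro k _ hk
    rw [lp.coeFn_smul, Pi.smul_apply, hP.levelBasis_apply w k hn, if_neg (Ne.symm hk), smul_zero]
  · intro h
    exact absurd (Finset.mem_Icc.2 (abs_le.1 hn)) h

theorem IsBranching.sum_smul_levelBasis_mem (hP : IsBranching J P) (w : ℤ) (c : ℤ → ℂ) :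
    ∑ k ∈ Finset.Icc (-w) w, c k • hP.levelBasis w k ∈ level P w :=
  sum_mem fun k _ => (level P w).smul_mem _ (hP.levelBasis_mem_level w k)

theorem IsBranching.tendsto_bracket_levelBasis (hP : IsBranching J P) (a : EllOne) (k : ℤ) :
    Tendsto (fun w : ℕ => bracket (hP.levelBasis w k) a) atTop (𝓝 (a k)) := by
  have h1 : a k = ∑' n, (if n = k then 1 else 0) * a n := by
    rw [tsum_eq_single k (fun n hn => by simp [hn])]
    simp
  rw [h1]
  refine tendsto_tsum_of_dominated_convergence a.summable_norm (fun n => ?_)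
    (Eventually.of_forall fun w n => ?_)
  · refine tendsto_const_nhds.congr' ?_
    filter_upwards [eventually_ge_atTop n.natAbs] with w hw
    rw [hP.levelBasis_apply]
    rw [Int.abs_eq_natAbs]
    omega
  · rw [norm_mul]
    exact mul_le_of_le_one_left (norm_nonneg _) (hP.norm_extend_single_le w k n)

/-! ### Weak* compactness of the unit ball -/

/-- `T x` as an element of `ℓ_∞(ℤ)`. -/
noncomputable def IsBranching.pullInfty (hP : IsBranching J P) (x : EllInfty) : EllInfty :=
  ⟨pull P x, memℓp_infty ⟨‖x‖, by
    rintro _ ⟨n, rfl⟩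
    by_cases hp : ∃ m, P n m
    · obtain ⟨m, hm⟩ := hp
      change ‖pull P x n‖ ≤ _
      rw [hP.pull_eq _ hm, ← averaging_apply]
      exact ((averaging x).norm_apply_le m).trans (norm_averaging_le x)
    · push Not at hp
      change ‖pull P x n‖ ≤ _
      rw [pull_eq_zero _ hp, norm_zero]
      exact norm_nonneg _⟩⟩

open Classical in
/-- The operator on `ℓ₁(ℤ)` which sends `δₙ` to `δ_m` if `m` is the parent of `n` and kills `δₙ`
if `n` is an orphan. -/
noncomputable def toParent (P : ℤ → ℤ → Prop) : EllOne → EllOne :=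
  synthesis fun n => if h : ∃ m, P n m then pointMass h.choose else 0

open Classical in
theorem norm_toParent_aux (n : ℤ) :
    ‖(if h : ∃ m, P n m then pointMass h.choose else 0 : EllOne)‖ ≤ 1 := by
  split_ifs
  · rw [norm_pointMass]
  · simp

open Classical in
theorem norm_toParent_le (a : EllOne) : ‖toParent P a‖ ≤ ‖a‖ :=
  norm_synthesis_le (fun n => norm_toParent_aux n) a

open Classical in
theorem IsBranching.bracket_toParent (hP : IsBranching J P) (x : EllInfty) (a : EllOne) :
    bracket (averaging x) (toParent P a) = bracket (hP.pullInfty x) a := by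
  rw [toParent, bracket_synthesis fun n => norm_toParent_aux n]
  refine tsum_congr fun n => ?_
  change _ = pull P x n * a n
  by_cases hp : ∃ m, P n m
  · rw [dif_pos hp, bracket_pointMass, averaging_apply, hP.pull_eq _ hp.choose_spec]
  · rw [dif_neg hp, pull_eq_zero _ (by simpa using hp)]
    simp [← bracketCLM_apply]

theorem IsBranching.tendsto_bracket_sub_toParent (hP : IsBranching J P) {α : Type*}
    {l : Filter α} {g : α → EllOne} {f : EllOne}
    (h : ∀ n, Tendsto (fun i => g i n) l (𝓝 (f n))) {x : EllInfty} (hx : x ∈ core P) :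
    Tendsto (fun i => bracket x (g i) - bracket x f -
      bracket (averaging x) (toParent P (g i - f))) l (𝓝 0) := by
  obtain ⟨w, hw⟩ := hx
  have h0 : ∀ n ∉ Finset.Icc (-w) w, (x - hP.pullInfty x) n = 0 := fun n hn => by
    have hn' : w < |n| := by
      by_contra! hle
      exact hn (Finset.mem_Icc.2 (abs_le.1 hle))
    change x n - pull P x n = 0
    rw [← hw n hn', sub_self]
  have h1 := (tendsto_bracket_of_pointwise h h0).sub_const (bracket (x - hP.pullInfty x) f)
  rw [sub_self] at h1
  refine h1.congr fun i => ?_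
  rw [hP.bracket_toParent, bracket_sub_left, bracket_sub_left, bracket_sub_right]
  ring

open Classical in
/-- The pointwise limit along `l` of a family in `ℓ₁(ℤ)`, if it exists in `ℓ₁(ℤ)`. -/
noncomputable def pointwiseLimit {α : Type*} (l : Filter α) (g : α → EllOne) : EllOne :=
  if h : ∃ f : EllOne, ∀ n, Tendsto (fun i => g i n) l (𝓝 (f n)) then h.choose else 0

theorem tendsto_pointwiseLimit {α : Type*} (U : Ultrafilter α) {g : α → EllOne} {C : ℝ}
    (hg : ∀ i, ‖g i‖ ≤ C) (n : ℤ) :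
    Tendsto (fun i => g i n) U (𝓝 (pointwiseLimit U g n)) := by
  have h := EllOne.exists_pointwise_limit U g hg
  rw [pointwiseLimit, dif_pos h]
  exact h.choose_spec n

/-- Subtract the pointwise limit and move to the parents. -/
noncomputable def descend {α : Type*} (P : ℤ → ℤ → Prop) (l : Filter α) (g : α → EllOne) (i : α) :
    EllOne :=
  toParent P (g i - pointwiseLimit l g)

theorem IsBranching.exists_weakStar_limit (hP : IsBranching J P) {α : Type*} (U : Ultrafilter α)
    {g : α → EllOne} {C : ℝ} (hg : ∀ i, ‖g i‖ ≤ C) :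
    ∃ f : EllOne, ∀ x ∈ core P, Tendsto (fun i => bracket x (g i)) U (𝓝 (bracket x f)) := by
  set G : ℕ → α → EllOne := fun k => (descend P (U : Filter α))^[k] g with hG
  set F : ℕ → EllOne := fun k => pointwiseLimit U (G k) with hF
  have hGs : ∀ k i, G (k + 1) i = toParent P (G k i - F k) := fun k i => by
    simp only [hG, hF, Function.iterate_succ_apply']
    rfl
  have hbdd : ∀ k, ∃ C : ℝ, ∀ i, ‖G k i‖ ≤ C := by
    intro k
    induction k with
    | zero => exact ⟨C, hg⟩
    | succ k ih =>
      obtain ⟨C, hC⟩ := ih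
      refine ⟨C + ‖F k‖, fun i => ?_⟩
      rw [hGs]
      exact (norm_toParent_le _).trans ((norm_sub_le _ _).trans (add_le_add_left (hC i) _))
  have hlim : ∀ k n, Tendsto (fun i => G k i n) U (𝓝 (F k n)) := fun k n =>
    tendsto_pointwiseLimit U (hbdd k).choose_spec n
  have hL : ∀ k, ∃ z, 0 ≤ z ∧ Tendsto (fun i => ‖G k i‖) U (𝓝 z) := fun k => by
    obtain ⟨z, h0, -, hz⟩ := exists_tendsto_real_of_bounded U (fun i => ‖G k i‖)
      (fun i => norm_nonneg _) (hbdd k).choose_spec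
    exact ⟨z, h0, hz⟩
  choose L hL0 hL using hL
  have hFL : ∀ k, ‖F k‖ ≤ L k - L (k + 1) := fun k => by
    refine le_of_tendsto_of_tendsto' (tendsto_norm_sub_norm_sub (hlim k))
      ((hL k).sub (hL (k + 1))) fun i => ?_
    rw [hGs]
    exact sub_le_sub_left (norm_toParent_le _) _
  have hsumL : ∀ N, ∑ k ∈ Finset.range N, ‖F k‖ ≤ L 0 - L N := fun N => by
    induction N with
    | zero => simp
    | succ N ih => rw [Finset.sum_range_succ]; linarith [hFL N]
  have hLle : ∀ N, L N ≤ L 0 := fun N => by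
    have : 0 ≤ ∑ k ∈ Finset.range N, ‖F k‖ := Finset.sum_nonneg fun k _ => norm_nonneg _
    linarith [hsumL N]
  have hsF : Summable fun k => ‖F k‖ :=
    summable_of_sum_range_le (fun k => norm_nonneg _) fun N => (hsumL N).trans
      (sub_le_self _ (hL0 N))
  have hsum : Summable fun k => preAveraging^[k] (F k) :=
    Summable.of_norm_bounded hsF fun k => norm_preAveraging_iterate_le k _
  refine ⟨∑' k, preAveraging^[k] (F k), fun x hx => ?_⟩
  have herr : ∀ N, Tendsto (fun i => bracket x (g i) -
      ∑ k ∈ Finset.range N, bracket ((averaging ^ k) x) (F k) -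
      bracket ((averaging ^ N) x) (G N i)) U (𝓝 0) := by
    intro N
    induction N with
    | zero => simp [hG]
    | succ N ih =>
      have h := ih.add (hP.tendsto_bracket_sub_toParent (hlim N)
        (hP.averaging_pow_mem_core hx N))
      rw [add_zero] at h
      refine h.congr fun i => ?_
      rw [Finset.sum_range_succ, averaging_pow_succ, hGs]
      ring
  obtain ⟨z, -, hz⟩ := (isCompact_closedBall (0 : ℂ) (‖x‖ * C)).ultrafilter_le_nhds
    (U.map fun i => bracket x (g i)) (by
      rw [le_principal_iff]
      refine mem_map.2 (Eventually.of_forall fun i => ?_)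
      simpa using (norm_bracket_le x (g i)).trans
        (mul_le_mul_of_nonneg_left (hg i) (norm_nonneg _)))
  have hz' : Tendsto (fun i => bracket x (g i)) U (𝓝 z) := hz
  have hbound : ∀ N, ‖z - ∑ k ∈ Finset.range N, bracket ((averaging ^ k) x) (F k)‖ ≤
      ‖(averaging ^ N) x‖ * L 0 := by
    intro N
    have h1 := (hz'.sub_const (∑ k ∈ Finset.range N, bracket ((averaging ^ k) x) (F k))).sub
      (herr N)
    simp only [sub_sub_cancel, sub_zero] at h1
    refine (le_of_tendsto_of_tendsto' h1.norm ((hL N).const_mul _)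
      fun i => norm_bracket_le _ _).trans ?_
    exact mul_le_mul_of_nonneg_left (hLle N) (norm_nonneg _)
  have hconv : Tendsto (fun N => ∑ k ∈ Finset.range N, bracket ((averaging ^ k) x) (F k)) atTop
      (𝓝 z) := by
    rw [tendsto_iff_norm_sub_tendsto_zero]
    have h2 := (hP.tendsto_norm_averaging_pow hx).mul_const (L 0)
    rw [zero_mul] at h2
    exact squeeze_zero (fun N => norm_nonneg _)
      (fun N => by rw [norm_sub_rev]; exact hbound N) h2
  have hval : bracket x (∑' k, preAveraging^[k] (F k)) = z := by
    have h3 := ((bracketCLM x).hasSum hsum.hasSum).tendsto_sum_nat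
    simp only [bracketCLM_apply, bracket_preAveraging_iterate] at h3
    exact tendsto_nhds_unique h3 hconv
  rw [hval]
  exact hz'

/-! ### The predual -/

/-- The predual of `ℓ₁(ℤ)` attached to a parent relation. -/
noncomputable def predual (P : ℤ → ℤ → Prop) : Submodule ℂ EllInfty := (core P).topologicalClosure

theorem core_le_predual : core P ≤ predual P := (core P).le_topologicalClosure

set_option synthInstance.maxHeartbeats 200000 in
theorem IsBranching.exists_approximation (hP : IsBranching J P) (φ : predual P →L[ℂ] ℂ) :
    ∃ g : ℕ → EllOne, (∀ w, ‖g w‖ ≤ ‖φ‖) ∧ ∀ x (hx : x ∈ core P),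
      ∀ᶠ w in atTop, bracket x (g w) = φ ⟨x, core_le_predual hx⟩ := by
  have hmem : ∀ w k, hP.levelBasis w k ∈ predual P := fun w k =>
    core_le_predual (level_le_core w (hP.levelBasis_mem_level w k))
  set d : ℤ → ℤ → predual P := fun w k => ⟨hP.levelBasis w k, hmem w k⟩ with hd
  have hcoe : ∀ (w : ℤ) (c : ℤ → ℂ), ((∑ k ∈ Finset.Icc (-w) w, c k • d w k : predual P) :
      EllInfty) = ∑ k ∈ Finset.Icc (-w) w, c k • hP.levelBasis w k := fun w c => by
    simp [hd]
  refine ⟨fun w => ∑ k ∈ Finset.Icc (-(w : ℤ)) w, φ (d w k) • pointMass k, fun w => ?_,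
    fun x hx => ?_⟩
  · obtain ⟨θ, hθ⟩ : ∃ θ : ℤ → ℂ, ∀ k, ‖θ k‖ ≤ 1 ∧ θ k * φ (d w k) = ‖φ (d w k)‖ := by
      have : ∀ z : ℂ, ∃ t : ℂ, ‖t‖ ≤ 1 ∧ t * z = ‖z‖ := fun z => by
        obtain ⟨t, ht, ht'⟩ := RCLike.exists_norm_eq_mul_self z
        exact ⟨t, ht.le, ht'.symm⟩
      choose θ h1 h2 using fun k => this (φ (d w k))
      exact ⟨θ, fun k => ⟨h1 k, h2 k⟩⟩
    have h1 : ‖(∑ k ∈ Finset.Icc (-(w : ℤ)) w, θ k • d w k : predual P)‖ ≤ 1 := by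
      change ‖((∑ k ∈ Finset.Icc (-(w : ℤ)) w, θ k • d w k : predual P) : EllInfty)‖ ≤ 1
      rw [hcoe]
      refine hP.norm_le_of_mem_level (hP.sum_smul_levelBasis_mem _ _) zero_le_one fun n hn => ?_
      rw [hP.sum_smul_levelBasis_apply _ _ hn]
      exact (hθ n).1
    have h2 : φ (∑ k ∈ Finset.Icc (-(w : ℤ)) w, θ k • d w k) =
        ((∑ k ∈ Finset.Icc (-(w : ℤ)) w, ‖φ (d w k)‖ : ℝ) : ℂ) := by
      rw [map_sum]
      push_cast
      exact Finset.sum_congr rfl fun k _ => by rw [map_smul, smul_eq_mul, (hθ k).2]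
    have h3 : ∑ k ∈ Finset.Icc (-(w : ℤ)) w, ‖φ (d w k)‖ ≤ ‖φ‖ := by
      have h4 := φ.le_opNorm (∑ k ∈ Finset.Icc (-(w : ℤ)) w, θ k • d w k)
      rw [h2, Complex.norm_real] at h4
      exact (le_abs_self _).trans (h4.trans (mul_le_of_le_one_right φ.opNorm_nonneg h1))
    refine (norm_sum_le _ _).trans (le_trans (le_of_eq ?_) h3)
    exact Finset.sum_congr rfl fun k _ => by rw [norm_smul, norm_pointMass, mul_one]
  · obtain ⟨w₀, hw₀⟩ := id hx
    filter_upwards [eventually_ge_atTop w₀.toNat] with w hw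
    have hx' : x ∈ level P w := level_mono (by omega) hw₀
    have h1 : (⟨x, core_le_predual hx⟩ : predual P) =
        ∑ k ∈ Finset.Icc (-(w : ℤ)) w, x k • d w k := by
      refine Subtype.ext ?_
      rw [hcoe]
      exact hP.eq_of_mem_level hx' (hP.sum_smul_levelBasis_mem _ _) fun n hn =>
        (hP.sum_smul_levelBasis_apply _ _ hn).symm
    rw [h1, map_sum, ← bracketCLM_apply, map_sum]
    refine Finset.sum_congr rfl fun k _ => ?_
    rw [map_smul, map_smul, bracketCLM_apply, bracket_pointMass, smul_eq_mul, smul_eq_mul,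
      mul_comm]

theorem eq_of_eqOn_core {φ ψ : predual P →L[ℂ] ℂ}
    (h : ∀ x (hx : x ∈ core P), φ ⟨x, core_le_predual hx⟩ = ψ ⟨x, core_le_predual hx⟩) :
    φ = ψ := by
  ext ⟨x, hx⟩
  obtain ⟨y, hy, hyx⟩ := mem_closure_iff_seq_limit.1 hx
  have ht : Tendsto (fun n => (⟨y n, core_le_predual (hy n)⟩ : predual P)) atTop
      (𝓝 ⟨x, hx⟩) := tendsto_subtype_rng.2 hyx
  refine tendsto_nhds_unique ((φ.continuous.tendsto _).comp ht) ?_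
  exact ((ψ.continuous.tendsto _).comp ht).congr fun n => (h _ (hy n)).symm

/-- The canonical map `ℓ₁(ℤ) → E*`. -/
noncomputable def toDual (E : Submodule ℂ EllInfty) : EllOne →L[ℂ] (E →L[ℂ] ℂ) :=
  LinearMap.mkContinuous₂
    (LinearMap.mk₂ ℂ (fun a (x : E) => bracket (x : EllInfty) a)
      (fun a b x => bracket_add_right x a b) (fun c a x => bracket_smul_right x c a)
      (fun a x y => bracket_add_left x y a) fun c a x => bracket_smul_left c x a)
    1 (fun a x => by
      rw [one_mul, mul_comm]
      exact norm_bracket_le x a)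

theorem toDual_apply (E : Submodule ℂ EllInfty) (a : EllOne) (x : E) :
    toDual E a x = bracket (x : EllInfty) a := rfl

theorem exists_equiv_dual_of_bijective {F : Type*} [NormedAddCommGroup F] [NormedSpace ℂ F]
    (f : EllOne →L[ℂ] (F →L[ℂ] ℂ)) (h : Function.Bijective f) :
    ∃ ι : EllOne ≃L[ℂ] (F →L[ℂ] ℂ), ∀ a, ι a = f a :=
  ⟨ContinuousLinearEquiv.ofBijective f (LinearMap.ker_eq_bot.2 h.1) (LinearMap.range_eq_top.2 h.2),
    fun _ => rfl⟩

theorem isPredual_of_bijective {E : Submodule ℂ EllInfty} (hE : IsClosed (E : Set EllInfty))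
    (h : Function.Bijective (toDual E)) : IsPredual E := by
  obtain ⟨ι, hι⟩ := exists_equiv_dual_of_bijective (toDual E) h
  exact ⟨hE, ι, fun a x => by rw [hι, toDual_apply]⟩

theorem IsBranching.toDual_injective (hP : IsBranching J P) :
    Function.Injective (toDual (predual P)) := by
  intro a b hab
  refine lp.ext (funext fun k => ?_)
  refine tendsto_nhds_unique (hP.tendsto_bracket_levelBasis a k)
    ((hP.tendsto_bracket_levelBasis b k).congr fun w => ?_)
  have hmem : hP.levelBasis w k ∈ predual P :=
    core_le_predual (level_le_core w (hP.levelBasis_mem_level w k))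
  have h := DFunLike.congr_fun hab (⟨_, hmem⟩ : predual P)
  rw [toDual_apply, toDual_apply] at h
  exact h.symm

theorem IsBranching.toDual_surjective (hP : IsBranching J P) :
    Function.Surjective (toDual (predual P)) := by
  intro φ
  obtain ⟨g, hg, hgφ⟩ := hP.exists_approximation φ
  obtain ⟨f, hf⟩ := hP.exists_weakStar_limit (hyperfilter ℕ) hg
  refine ⟨f, eq_of_eqOn_core fun x hx => ?_⟩
  rw [toDual_apply]
  refine tendsto_nhds_unique (hf x hx) (tendsto_const_nhds.congr' ?_)
  have : ∀ᶠ w in (hyperfilter ℕ : Filter ℕ), bracket x (g w) = φ ⟨x, core_le_predual hx⟩ :=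
    Nat.hyperfilter_le_atTop (hgφ x hx)
  filter_upwards [this] with w hw using hw.symm

theorem IsBranching.isPredual (hP : IsBranching J P) : IsPredual (predual P) :=
  isPredual_of_bijective (core P).isClosed_topologicalClosure
    ⟨hP.toDual_injective, hP.toDual_surjective⟩

theorem backShift_bilateralShift (x : EllInfty) : backShift (bilateralShift x) = x :=
  lp.ext (funext fun n => by simp)

theorem continuous_bilateralShift : Continuous bilateralShift := by
  refine (LipschitzWith.of_dist_le_mul (K := 1) fun x y => ?_).continuous
  rw [NNReal.coe_one, one_mul, dist_eq_norm, dist_eq_norm]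
  exact EllInfty.norm_le (norm_nonneg _) fun n => (x - y).norm_apply_le (n - 1)

theorem IsBranching.isShiftInvariantPredual (hP : IsBranching J P) :
    IsShiftInvariantPredual (predual P) := by
  refine ⟨hP.isPredual, fun x => ⟨fun hx => ?_, fun hx => ?_⟩⟩
  · rw [← backShift_bilateralShift x]
    exact map_mem_closure backShift.continuous hx fun y hy => hP.backShift_mem_core hy
  · exact map_mem_closure continuous_bilateralShift hx fun y hy => hP.bilateralShift_mem_core hy

theorem IsBranching.tendsto_apply_add (hP : IsBranching J P) {x : EllInfty} (hx : x ∈ predual P)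
    (t : ℤ) : Tendsto (fun j => x (t + j)) (cofinite ⊓ 𝓟 J) (𝓝 (averaging x t)) := by
  have hcore : ∀ y ∈ core P, ∀ᶠ j in cofinite ⊓ 𝓟 J, y (t + j) = averaging y t := by
    rintro y ⟨w, hw⟩
    obtain ⟨N, hN⟩ := hP.eventually t
    rw [eventually_inf_principal]
    have hfin : (Set.Icc (-(|N| + |w| + |t|)) (|N| + |w| + |t|)).Finite := Set.finite_Icc _ _
    filter_upwards [hfin.compl_mem_cofinite] with j hj hjJ
    have hj' : |N| + |w| + |t| < |j| := by
      by_contra! hle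
      exact hj (abs_le.1 hle)
    have h1 := le_abs_self N
    have h2 := le_abs_self w
    have h3 : |j| ≤ |t + j| + |t| := by
      have := abs_sub (t + j) t
      simpa using this
    have h4 := abs_nonneg t
    have h5 := abs_nonneg w
    have h6 := abs_nonneg N
    rw [hw _ (by omega), hP.pull_eq _ (hN j hjJ (by omega)), averaging_apply]
  rw [Metric.tendsto_nhds]
  intro ε hε
  obtain ⟨y, hy, hxy⟩ := Metric.mem_closure_iff.1 hx (ε / 3) (by positivity)
  rw [dist_eq_norm] at hxy
  filter_upwards [hcore y hy] with j hj
  have e : x (t + j) - averaging x t = (x - y) (t + j) - averaging (x - y) t := by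
    rw [map_sub, lp.coeFn_sub, lp.coeFn_sub, Pi.sub_apply, Pi.sub_apply, hj]
    ring
  rw [dist_eq_norm, e]
  have h1 := (x - y).norm_apply_le (t + j)
  have h2 := ((averaging (x - y)).norm_apply_le t).trans (norm_averaging_le _)
  have h3 := norm_sub_le ((x - y) (t + j)) (averaging (x - y) t)
  linarith

end Predual

/-! ### Functionals on `c₀` -/

namespace CZero

theorem norm_le {f : C₀(ℕ, ℂ)} {C : ℝ} (hC : 0 ≤ C) (h : ∀ n, ‖f n‖ ≤ C) : ‖f‖ ≤ C := by
  rw [← ZeroAtInftyContinuousMap.norm_toBCF_eq_norm]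
  exact (BoundedContinuousFunction.norm_le hC).2 h

theorem norm_apply_le (f : C₀(ℕ, ℂ)) (n : ℕ) : ‖f n‖ ≤ ‖f‖ := by
  rw [← ZeroAtInftyContinuousMap.norm_toBCF_eq_norm]
  exact f.toBCF.norm_coe_le_norm n

/-- The unit vectors of `c₀`. -/
noncomputable def unitVector (i : ℕ) : C₀(ℕ, ℂ) where
  toFun := Pi.single i 1
  continuous_toFun := continuous_of_discreteTopology
  zero_at_infty' := by
    rw [cocompact_eq_cofinite]
    refine tendsto_const_nhds.congr' ?_
    filter_upwards [(Set.finite_singleton i).compl_mem_cofinite] with n hn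
    exact (Pi.single_eq_of_ne (M := fun _ : ℕ => ℂ) (by simpa using hn) _).symm

theorem unitVector_apply (i n : ℕ) : unitVector i n = if n = i then 1 else 0 := by
  change (Pi.single i 1 : ℕ → ℂ) n = _
  rw [Pi.single_apply]

theorem sum_smul_unitVector_apply (s : Finset ℕ) (c : ℕ → ℂ) (n : ℕ) :
    (∑ i ∈ s, c i • unitVector i) n = if n ∈ s then c n else 0 := by
  have h : (∑ i ∈ s, c i • unitVector i) n = ∑ i ∈ s, (c i • unitVector i) n := by
    induction s using Finset.induction_on with
    | empty => simp
    | insert a s ha ih =>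
      rw [Finset.sum_insert ha, Finset.sum_insert ha, ZeroAtInftyContinuousMap.add_apply, ih]
  rw [h]
  simp [unitVector_apply]

theorem sum_norm_le (F : C₀(ℕ, ℂ) →L[ℂ] ℂ) (s : Finset ℕ) :
    ∑ i ∈ s, ‖F (unitVector i)‖ ≤ ‖F‖ := by
  have hex : ∀ z : ℂ, ∃ t : ℂ, ‖t‖ ≤ 1 ∧ t * z = ‖z‖ := fun z => by
    obtain ⟨t, ht, ht'⟩ := RCLike.exists_norm_eq_mul_self z
    exact ⟨t, ht.le, ht'.symm⟩
  choose θ h1 h2 using fun i => hex (F (unitVector i))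
  have hn : ‖∑ i ∈ s, θ i • unitVector i‖ ≤ 1 := norm_le zero_le_one fun n => by
    rw [sum_smul_unitVector_apply]
    split_ifs
    · exact h1 n
    · simp
  have hv : F (∑ i ∈ s, θ i • unitVector i) = ((∑ i ∈ s, ‖F (unitVector i)‖ : ℝ) : ℂ) := by
    rw [map_sum]
    push_cast
    exact Finset.sum_congr rfl fun i _ => by rw [map_smul, smul_eq_mul, h2]
  have h := F.le_opNorm (∑ i ∈ s, θ i • unitVector i)
  rw [hv, Complex.norm_real] at h
  exact (le_abs_self _).trans (h.trans (mul_le_of_le_one_right (norm_nonneg _) hn))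

theorem summable_norm (F : C₀(ℕ, ℂ) →L[ℂ] ℂ) : Summable fun i => ‖F (unitVector i)‖ :=
  summable_of_sum_le (fun _ => norm_nonneg _) (sum_norm_le F)

theorem tsum_norm_le (F : C₀(ℕ, ℂ) →L[ℂ] ℂ) : ∑' i, ‖F (unitVector i)‖ ≤ ‖F‖ :=
  (summable_norm F).tsum_le_of_sum_le (sum_norm_le F)

theorem tendsto_sum_smul_unitVector (f : C₀(ℕ, ℂ)) :
    Tendsto (fun N => ∑ i ∈ Finset.range N, f i • unitVector i) atTop (𝓝 f) := by
  have h0 : Tendsto f atTop (𝓝 0) := by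
    have := f.zero_at_infty'
    rwa [cocompact_eq_cofinite, Nat.cofinite_eq_atTop] at this
  rw [Metric.tendsto_atTop] at h0 ⊢
  intro ε hε
  obtain ⟨N₀, hN₀⟩ := h0 (ε / 2) (by positivity)
  refine ⟨N₀, fun N hN => lt_of_le_of_lt ?_ (half_lt_self hε)⟩
  rw [dist_eq_norm]
  refine norm_le (by positivity) fun n => ?_
  rw [ZeroAtInftyContinuousMap.sub_apply, sum_smul_unitVector_apply]
  split_ifs with hn
  · simp only [sub_self, norm_zero]
    positivity
  · have := hN₀ n (hN.trans (by simpa using hn))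
    rw [dist_zero_right] at this
    simpa using this.le

theorem norm_le_tsum_norm (F : C₀(ℕ, ℂ) →L[ℂ] ℂ) : ‖F‖ ≤ ∑' i, ‖F (unitVector i)‖ := by
  refine F.opNorm_le_bound (tsum_nonneg fun _ => norm_nonneg _) fun f => ?_
  refine le_of_tendsto' ((F.continuous.tendsto _).comp (tendsto_sum_smul_unitVector f)).norm
    fun N => ?_
  rw [Function.comp_apply, map_sum]
  refine (norm_sum_le _ _).trans ?_
  calc ∑ i ∈ Finset.range N, ‖F (f i • unitVector i)‖
      ≤ ∑ i ∈ Finset.range N, ‖F (unitVector i)‖ * ‖f‖ := by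
        refine Finset.sum_le_sum fun i _ => ?_
        rw [map_smul, norm_smul, mul_comm]
        exact mul_le_mul_of_nonneg_left (norm_apply_le f i) (norm_nonneg _)
    _ = (∑ i ∈ Finset.range N, ‖F (unitVector i)‖) * ‖f‖ := by rw [Finset.sum_mul]
    _ ≤ _ := mul_le_mul_of_nonneg_right
        ((summable_norm F).sum_le_tsum _ fun _ _ => norm_nonneg _) (norm_nonneg _)

theorem tsum_norm_eq (F : C₀(ℕ, ℂ) →L[ℂ] ℂ) : ∑' i, ‖F (unitVector i)‖ = ‖F‖ :=
  le_antisymm (tsum_norm_le F) (norm_le_tsum_norm F)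

/-- In `c₀*`, the norm is asymptotically additive along weak*-convergent families. -/
theorem tendsto_norm_sub_norm_sub {α : Type*} {l : Filter α} {G : α → C₀(ℕ, ℂ) →L[ℂ] ℂ}
    {F : C₀(ℕ, ℂ) →L[ℂ] ℂ} (h : ∀ f, Tendsto (fun a => G a f) l (𝓝 (F f))) :
    Tendsto (fun a => ‖G a‖ - ‖G a - F‖) l (𝓝 ‖F‖) := by
  simp only [← tsum_norm_eq]
  exact tendsto_tsum_norm_sub_tsum_norm_sub (summable_norm F) (fun a => summable_norm (G a))
    fun i => h _

end CZero

theorem exists_norm_bounds {E F : Type*} [NormedAddCommGroup E] [NormedSpace ℂ E]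
    [NormedAddCommGroup F] [NormedSpace ℂ F] (Φ : E ≃L[ℂ] F) :
    ∃ c C : ℝ, 0 < c ∧ 0 ≤ C ∧ (∀ a, c * ‖a‖ ≤ ‖Φ a‖) ∧ (∀ a, ‖Φ a‖ ≤ C * ‖a‖) ∧
      ∀ a b, Φ (a - b) = Φ a - Φ b := by
  set K := ‖(Φ.symm : F →L[ℂ] E)‖ with hK
  have hK0 : 0 ≤ K := norm_nonneg _
  refine ⟨1 / (K + 1), ‖(Φ : E →L[ℂ] F)‖, by positivity, norm_nonneg _, fun a => ?_,
    (Φ : E →L[ℂ] F).le_opNorm, fun a b => map_sub Φ a b⟩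
  have h1 : ‖a‖ ≤ K * ‖Φ a‖ := by
    simpa using (Φ.symm : F →L[ℂ] E).le_opNorm (Φ a)
  have h2 := norm_nonneg (Φ a)
  rw [one_div, inv_mul_le_iff₀ (by positivity)]
  linarith

theorem exists_norm_bounds_of_equiv_dual {F : Type*} [NormedAddCommGroup F] [NormedSpace ℂ F]
    (Φ : EllOne ≃L[ℂ] (F →L[ℂ] ℂ)) :
    ∃ c C : ℝ, 0 < c ∧ 0 ≤ C ∧ (∀ a, c * ‖a‖ ≤ ‖Φ a‖) ∧ (∀ a, ‖Φ a‖ ≤ C * ‖a‖) ∧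
      ∀ a b, Φ (a - b) = Φ a - Φ b :=
  exists_norm_bounds Φ

/-- If `E* = ℓ₁(ℤ)` contains bounded weak*-convergent trees of infinite height whose branches are
separated, then `E` is not isomorphic to `c₀`. -/
theorem isEmpty_equiv_czero {F : Type*} [NormedAddCommGroup F] [NormedSpace ℂ F]
    (ι : EllOne ≃L[ℂ] (F →L[ℂ] ℂ)) {l : Filter ℤ} [l.NeBot] {b : ℕ → ℤ → EllOne} {ε C : ℝ}
    (hε : 0 < ε) (hb : ∀ t, ‖b 0 t‖ ≤ C)
    (hlim : ∀ r t x, Tendsto (fun j => ι (b r (t + j)) x) l (𝓝 (ι (b (r + 1) t) x)))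
    (hsep : ∀ r t, ∀ᶠ j in l, ε ≤ ‖b r (t + j) - b (r + 1) t‖) : IsEmpty (F ≃L[ℂ] C₀(ℕ, ℂ)) := by
  refine ⟨fun Ψ => ?_⟩
  set Φ : EllOne ≃L[ℂ] (C₀(ℕ, ℂ) →L[ℂ] ℂ) :=
    ι.trans (Ψ.arrowCongr (ContinuousLinearEquiv.refl ℂ ℂ)) with hΦ
  have hΦa : ∀ a f, Φ a f = ι a (Ψ.symm f) := fun a f => rfl
  obtain ⟨c, M, hc, hM, hcΦ, hMΦ, hsub⟩ :=
    exists_norm_bounds_of_equiv_dual Φ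
  have key : ∀ r : ℕ, ∀ t, ‖Φ (b r t)‖ ≤ M * C - r * (c * ε) := by
    intro r
    induction r with
    | zero =>
      intro t
      simpa using (hMΦ (b 0 t)).trans (mul_le_mul_of_nonneg_left (hb t) hM)
    | succ r ih =>
      intro t
      have h1 : Tendsto (fun j => ‖Φ (b r (t + j))‖ - ‖Φ (b r (t + j)) - Φ (b (r + 1) t)‖) l
          (𝓝 ‖Φ (b (r + 1) t)‖) :=
        CZero.tendsto_norm_sub_norm_sub fun f => hlim r t _
      refine le_of_tendsto h1 ?_
      filter_upwards [hsep r t] with j hj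
      rw [← hsub]
      have h2 := hcΦ (b r (t + j) - b (r + 1) t)
      have h3 := mul_le_mul_of_nonneg_left hj hc.le
      have h4 := ih (t + j)
      push_cast
      linarith
  obtain ⟨r, hr⟩ := exists_nat_gt (M * C / (c * ε))
  rw [div_lt_iff₀ (by positivity)] at hr
  have := (Φ (b r 0)).opNorm_nonneg.trans (key r 0)
  linarith

/-- The indicator function of `{n : M < |n|}`. -/
noncomputable def farIndicator (M : ℤ) : EllInfty :=
  ⟨fun n : ℤ => if M < |n| then 1 else 0, memℓp_infty ⟨1, by
    rintro _ ⟨n, rfl⟩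
    dsimp only
    split_ifs <;> simp⟩⟩

theorem farIndicator_apply (M n : ℤ) : farIndicator M n = if M < |n| then 1 else 0 := rfl

theorem norm_farIndicator_le (M : ℤ) : ‖farIndicator M‖ ≤ 1 :=
  EllInfty.norm_le zero_le_one fun n => by
    rw [farIndicator_apply]
    split_ifs <;> simp

theorem averaging_pow_farIndicator (M : ℤ) (r : ℕ) {n : ℤ} (hn : M + r < |n|) :
    (averaging ^ r) (farIndicator M) n = 1 := by
  induction r generalizing n with
  | zero => simpa [farIndicator_apply] using hn
  | succ r ih =>
    push_cast at hn
    have h : |n| ≤ |n + 1| + 1 := by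
      have := abs_sub (n + 1) 1
      simpa using this
    rw [averaging_pow_succ, averaging_apply, ih (by omega), ih (by omega)]
    norm_num

theorem tendsto_bracket_farIndicator (a : EllOne) :
    Tendsto (fun M : ℕ => bracket (farIndicator M) a) atTop (𝓝 0) := by
  rw [← tsum_zero (α := ℂ) (β := ℤ)]
  refine tendsto_tsum_of_dominated_convergence a.summable_norm (fun n => ?_)
    (Eventually.of_forall fun M n => ?_)
  · refine tendsto_const_nhds.congr' ?_
    filter_upwards [eventually_ge_atTop n.natAbs] with M hM
    rw [farIndicator_apply, if_neg (by rw [Int.abs_eq_natAbs]; omega), zero_mul]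
  · rw [norm_mul]
    exact mul_le_of_le_one_left (norm_nonneg _)
      (((farIndicator M).norm_apply_le n).trans (norm_farIndicator_le M))

theorem eventually_half_le_norm_sub (r : ℕ) (t : ℤ) (a : EllOne) :
    ∀ᶠ j in cofinite, 1 / 2 ≤ ‖preAveraging^[r] (pointMass (t + j)) - a‖ := by
  obtain ⟨M, hM⟩ := ((tendsto_bracket_farIndicator a).eventually
    (Metric.ball_mem_nhds 0 (by norm_num : (0 : ℝ) < 1 / 2))).exists
  rw [dist_zero_right] at hM
  filter_upwards [(Set.finite_Icc (-(M + r + |t|)) (M + r + |t|)).compl_mem_cofinite] with j hj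
  have hj' : (M : ℤ) + r < |t + j| := by
    by_contra! hle
    refine hj (abs_le.1 ?_)
    have := abs_sub (t + j) t
    simp only [add_sub_cancel_left] at this
    omega
  have h1 := norm_bracket_le (farIndicator M) (preAveraging^[r] (pointMass (t + j)) - a)
  rw [bracket_sub_right, bracket_preAveraging_iterate, bracket_pointMass,
    averaging_pow_farIndicator _ _ hj'] at h1
  have h2 := h1.trans (mul_le_of_le_one_left (norm_nonneg _) (norm_farIndicator_le M))
  have h3 := norm_sub_norm_le 1 (bracket (farIndicator M) a)
  rw [norm_one] at h3
  linarith

section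

variable {J : Set ℤ} {P : ℤ → ℤ → Prop}

theorem IsBranching.averaging_mem_predual (hP : IsBranching J P) {x : EllInfty}
    (hx : x ∈ predual P) : averaging x ∈ predual P :=
  map_mem_closure averaging.continuous hx fun _ hy => hP.averaging_mem_core hy

theorem IsBranching.averaging_pow_mem_predual (hP : IsBranching J P) {x : EllInfty}
    (hx : x ∈ predual P) (r : ℕ) : (averaging ^ r) x ∈ predual P := by
  induction r with
  | zero => simpa using hx
  | succ r ih =>
    rw [averaging_pow_succ]
    exact hP.averaging_mem_predual ih

theorem IsBranching.isEmpty_equiv_czero (hP : IsBranching J P) (hJ : J.Infinite) :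
    IsEmpty (predual P ≃L[ℂ] C₀(ℕ, ℂ)) := by
  obtain ⟨-, ι, hι⟩ := hP.isPredual
  have : (cofinite ⊓ 𝓟 J : Filter ℤ).NeBot := hJ.cofinite_inf_principal_neBot
  refine _root_.isEmpty_equiv_czero ι (l := cofinite ⊓ 𝓟 J)
    (b := fun r t => preAveraging^[r] (pointMass t)) (ε := 1 / 2) (C := 1) (by norm_num)
    (fun t => (norm_pointMass t).le) (fun r t x => ?_)
    fun r t => (eventually_half_le_norm_sub r t _).filter_mono inf_le_left
  simp only [hι, bracket_preAveraging_iterate, bracket_pointMass, averaging_pow_succ]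
  exact hP.tendsto_apply_add (hP.averaging_pow_mem_predual x.2 r) t

end

theorem FarApart.exists_predual {J : Set ℤ} (hJ : FarApart J) (hJ' : J.Infinite) :
    ∃ E : Submodule ℂ EllInfty, IsShiftInvariantPredual E ∧
      WeakStarTendsto E pointMass (cofinite ⊓ 𝓟 J)
        ((1 / 2 : ℂ) • (pointMass 0 + pointMass 1)) ∧
      IsEmpty (E ≃L[ℂ] C₀(ℕ, ℂ)) := by
  obtain ⟨q, τ, h⟩ := hJ.exists_isScale
  have hP := h.isBranching
  refine ⟨predual (Parent J q τ), hP.isShiftInvariantPredual, fun x hx => ?_,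
    hP.isEmpty_equiv_czero hJ'⟩
  have h1 := hP.tendsto_apply_add hx 0
  have h2 := bracket_half_smul_pointMass_add x 0
  simp only [zero_add] at h1 h2
  simpa only [h2, bracket_pointMass] using h1

theorem farApart_range_sq : FarApart (Set.range fun n : ℕ => (n : ℤ) ^ 2) := by
  intro G
  refine ⟨G ^ 2, ?_⟩
  rintro _ ⟨a, rfl⟩ ha _ ⟨b, rfl⟩ hne
  have ha0 : (0 : ℤ) ≤ a := by positivity
  have hb0 : (0 : ℤ) ≤ b := by positivity
  simp only [abs_of_nonneg (sq_nonneg (a : ℤ))] at ha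
  have hGa : G < a := by nlinarith
  have hab : (a : ℤ) ≠ b := fun h => hne (by simp [h])
  have h1 : 1 ≤ |(a : ℤ) - b| := Int.one_le_abs (sub_ne_zero.2 hab)
  have h2 : |(a : ℤ) ^ 2 - (b : ℤ) ^ 2| = (a + b) * |(a : ℤ) - b| := by
    rw [sq_sub_sq, abs_mul, abs_of_nonneg (add_nonneg ha0 hb0)]
  simp only [h2]
  nlinarith

theorem infinite_range_sq : (Set.range fun n : ℕ => (n : ℤ) ^ 2).Infinite := by
  refine Set.infinite_range_of_injective fun a b h => ?_
  simpa using h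

theorem theorem5p8 :
    (∃ E : Submodule ℂ EllInfty,
      IsShiftInvariantPredual E ∧ IsEmpty (E ≃L[ℂ] C₀(ℕ, ℂ))) ∧
    ∀ J : Set ℤ, AdditivelySparse J →
      ∃ E : Submodule ℂ EllInfty,
        IsShiftInvariantPredual E ∧
        WeakStarTendsto E pointMass (cofinite ⊓ 𝓟 J)
          ((1 / 2 : ℂ) • (pointMass 0 + pointMass 1)) ∧
        IsEmpty (E ≃L[ℂ] C₀(ℕ, ℂ)) := by
  refine ⟨?_, fun J hJ => hJ.farApart.exists_predual hJ.1⟩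
  obtain ⟨E, hE, -, hE'⟩ := farApart_range_sq.exists_predual infinite_range_sq
  exact ⟨E, hE, hE'⟩
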